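/- **Setting.** Let $A=\mathbb F_q[T]$, $K=\mathbb F_q(T)$, $K_\infty$ the completion of $K$ at $1/T$ (with $|T|=q$), $\mathbb C_\infty$ the completion of an algebraic closure of $K_\infty$, and $\Omega=\mathbb C_\infty\setminus K_\infty$ the Drinfeld upper half-plane, on which $GL_2(K)$ acts by fractional linear transformations. For $\gamma=\begin{pmatrix}a&b\\c&d\end{pmatrix}\in GL_2(K)$, $k,m\in\mathbb Z$ and $f:\Omega\to\mathbb C_\infty$ put $(f|_{k,m}\gamma)(z)=(\det\gamma)^m(cz+d)^{-k}f(\gamma z)$. For an ideal $\mathfrak m\subseteq A$, $\Gamma_0(\mathfrak m)\subseteq GL_2(A)$ is the group of matrices with $c\in\mathfrak m$; let $\Gamma$ denote such a group with $\mathfrak m\neq0$. **Forms.** A rigid analytic $f:\Omega\to\mathbb C_\infty$ is a Drinfeld quasi-modular form of weight $k$, type $m$ and depth $\le\ell$ for $\Gamma$, written $f\in\widetilde M^{\le\ell}_{k,m}(\Gamma)$, if there are rigid analytic functions $f_0,\dots,f_\ell$ on $\Omega$, each periodic under some nonzero ideal of $A$, such that $(f|_{k,m}\gamma)(z)=\sum_{i=0}^\ell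 f_i(z)\left(\frac{c}{cz+d}\right)^i$ for all $z\in\Omega$ and $\gamma\in\Gamma$, and such that for all $i$ and all $\gamma\in GL_2(K)$ the function $f_i|_{k-2i,m-i}\gamma$ is bounded as $\inf_{x\in K_\infty}|z-x|\to\infty$. The polynomial $P_f=\sum_i f_iX^i$ is the (unique) associated polynomial of $f$. Put $M_{k,m}(\Gamma)=\widetilde M^{\le0}_{k,m}(\Gamma)$ (modular forms). **The false Eisenstein series.** Let $\tilde\pi$ be a fixed period of the Carlitz module, i.e. $\tilde\pi\ne0$ and the zero set of $e_C(z)=\sum_{i\ge0}z^{q^i}/\prod_{j<i}(T^{q^i}-T^{q^j})$ is $\tilde\pi A$. Put $E(z)=\tilde\pi^{-1}\sum_{a\in A\text{ monic}}\ \sum_{b\in A}\frac{a}{az+b}$. The $E$-expansion of $f\in\widetilde M^{\le\ell}_{k,m}(\Gamma)$ is $f=\sum_{i=0}^\ell f_{i,E}E^i$, where $f_{i,E}=(-\tilde\pi)^i\sum_{h=i}^\ell\binom hi f_h(\tilde\pi E)^{h-i}\in M_{k-2i,m-i}(\Gamma)$. **Operators.** For $\gamma\in GL_2(K)$ and $f\in\widetilde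 M^{\le\ell}_{k,m}(\Gamma)$ put $(f\|_{k,m}\gamma)(z)=\sum_i\left(\frac{-c}{cz+d}\right)^i(f_i|_{k-2i,m-i}\gamma)(z)$, and for $\eta\in GL_2(K)$ put $T_\eta(f)=(\det\eta)^{k-m}\sum_\gamma f\|_{k,m}\gamma$, with $\gamma$ running over any finite set of representatives of $\Gamma\backslash\Gamma\eta\Gamma$. Let $\mathfrak p=(\wp)$ be a prime of $A$ with $\wp$ monic, let $\mathfrak m$ be a nonzero ideal with $\mathfrak p\nmid\mathfrak m$, and let $\eta=\begin{pmatrix}1&0\\0&\wp\end{pmatrix}$. Then $T_{\mathfrak p}$ is $T_\eta$ for $\Gamma_0(\mathfrak m)$ and $U_{\mathfrak p}$ is $T_\eta$ for $\Gamma_0(\mathfrak m\mathfrak p)$. Put $(\delta_{\mathfrak p}f)(z)=f(\wp z)$ and $E_{\mathfrak p}=E-\wp\,\delta_{\mathfrak p}E$. **Theorem.** Let $n\ge0$, $k,m\in\mathbb Z$ and $f\in M_{k-2n,m-n}(\Gamma_0(\mathfrak m))$. Then $fE^n\in\widetilde M^{\le n}_{k,m}(\Gamma_0(\mathfrak m))$,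 $fE_{\mathfrak p}^{n-h}\in M_{k-2h,m-h}(\Gamma_0(\mathfrak m\mathfrak p))$ for $0\le h\le n$ (so that $T_{\mathfrak p}$ and $U_{\mathfrak p}$ apply to them), $T_{\mathfrak p}(fE^n)\in\widetilde M^{\le n}_{k,m}(\Gamma_0(\mathfrak m))$, and its $E$-expansion is $$T_{\mathfrak p}(fE^n)=\sum_{h=0}^n\binom nh\wp^h\Bigl[\wp^{k-n-h}\,\delta_{\mathfrak p}f\,(-E_{\mathfrak p})^{n-h}+U_{\mathfrak p}\bigl(fE_{\mathfrak p}^{n-h}\bigr)\Bigr]E^h ;$$ that is, for $0\le h\le n$ the coefficient of $E^h$ on the right is $(T_{\mathfrak p}(fE^n))_{h,E}$, and lies in $M_{k-2h,m-h}(\Gamma_0(\mathfrak m))$. -/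

import Mathlib

open Polynomial
open scoped NNReal WithZero

noncomputable section

namespace DrinfeldQM

/-! ### The fields `K_∞` and `ℂ_∞`

`F` is the finite field `𝔽_q`, `F[X]` is `A = 𝔽_q[T]`, and `RatFunc F` is `K = 𝔽_q(T)`. -/

/-- `K_∞`: the completion of `𝔽_q(T)` at the place `∞ = 1/T`. -/
abbrev KInf (F : Type*) [Field F] : Type _ :=
  @RatFunc.CompletionAtInfty F _ (Classical.decEq _)

theorem valued_KInf_algebraMap (F : Type*) [Field F] (r : RatFunc F) :
    (Valued.v : Valuation (KInf F) ℤᵐ⁰) (algebraMap (RatFunc F) (KInf F) r) =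
      @RatFunc.inftyValuation F _ (Classical.decEq _) r := by
  exact @Valued.extensionValuation_apply_coe (RatFunc F) _ ℤᵐ⁰ _
    (@RatFunc.inftyValued F _ (Classical.decEq _)) r

/-- The cardinality `q` of the constant field, as a nonnegative real number. -/
def qCard (F : Type*) [Fintype F] : ℝ≥0 := (Fintype.card F : ℝ≥0)

theorem one_lt_qCard (F : Type*) [Field F] [Fintype F] : 1 < qCard F := by
  unfold qCard
  exact_mod_cast Fintype.one_lt_card

/-- The valuation at infinity has rank one; the embedding of its value group in the positive
reals is normalised by `|T| = q`. -/
instance instRankOneKInf (F : Type*) [Field F] [Fintype F] :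
    (Valued.v : Valuation (KInf F) ℤᵐ⁰).RankOne where
  hom' := (WithZeroMulInt.toNNReal (one_lt_qCard F).ne_zero).comp
    MonoidWithZeroHom.ValueGroup₀.embedding
  strictMono' := (WithZeroMulInt.toNNReal_strictMono (one_lt_qCard F)).comp
    MonoidWithZeroHom.ValueGroup₀.embedding_strictMono
  exists_val_nontrivial := by
    refine ⟨algebraMap (RatFunc F) (KInf F) RatFunc.X, ?_, ?_⟩
    · rw [valued_KInf_algebraMap, RatFunc.inftyValuation.X]
      exact WithZero.exp_ne_zero
    · rw [valued_KInf_algebraMap, RatFunc.inftyValuation.X]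
      simp [← WithZero.exp_zero]

/-- `K_∞` with the absolute value `|·|_∞`, normalised by `|T|_∞ = q`. -/
instance instNormedKInf (F : Type*) [Field F] [Fintype F] : NontriviallyNormedField (KInf F) :=
  Valued.toNontriviallyNormedField (KInf F) ℤᵐ⁰

instance instCompleteKInf (F : Type*) [Field F] [Fintype F] : CompleteSpace (KInf F) :=
  inferInstanceAs (CompleteSpace (@UniformSpace.Completion (RatFunc F)
    (@RatFunc.inftyValued F _ (Classical.decEq _)).toUniformSpace))

instance instUltraKInf (F : Type*) [Field F] [Fintype F] : IsUltrametricDist (KInf F) :=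
  inferInstanceAs (@IsUltrametricDist (KInf F) (Valued.toNormedField (KInf F) ℤᵐ⁰).toDist)

/-- On `K` the absolute value is `|r|_∞ = q ^ deg r`. -/
theorem norm_KInf_algebraMap (F : Type*) [Field F] [Fintype F] (r : RatFunc F) (hr : r ≠ 0) :
    ‖algebraMap (RatFunc F) (KInf F) r‖ = (Fintype.card F : ℝ) ^ r.intDegree := by
  change ((WithZeroMulInt.toNNReal (one_lt_qCard F).ne_zero
    (MonoidWithZeroHom.ValueGroup₀.embedding ((Valued.v : Valuation (KInf F) ℤᵐ⁰).restrict
      (algebraMap (RatFunc F) (KInf F) r))) : ℝ≥0) : ℝ) = _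
  rw [Valuation.embedding_restrict, valued_KInf_algebraMap, RatFunc.inftyValuation_apply,
    @RatFunc.inftyValuation_of_nonzero F _ (Classical.decEq _) r hr,
    WithZeroMulInt.toNNReal_neg_apply _ WithZero.exp_ne_zero]
  simp [qCard, WithZero.exp]

/-- An algebraic closure of `K_∞`, with the unique extension of the absolute value of `K_∞`. -/
abbrev AlgClInf (F : Type*) [Field F] : Type _ := AlgebraicClosure (KInf F)

instance instNormedAlgClInf (F : Type*) [Field F] [Fintype F] :
    NontriviallyNormedField (AlgClInf F) :=
  spectralNorm.nontriviallyNormedField (KInf F) (AlgClInf F)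

instance instNormedAlgebraAlgClInf (F : Type*) [Field F] [Fintype F] :
    NormedAlgebra (KInf F) (AlgClInf F) :=
  spectralNorm.normedAlgebra _ _

/-- `ℂ_∞`: the completion of an algebraic closure of `K_∞`. -/
abbrev CInf (F : Type*) [Field F] [Fintype F] : Type _ := UniformSpace.Completion (AlgClInf F)

section

variable {F : Type*} [Field F] [Fintype F]

/-- The embedding of `K = 𝔽_q(T)` in `ℂ_∞`. -/
def embK : RatFunc F →+* CInf F :=
  (algebraMap (KInf F) (CInf F)).comp (algebraMap (RatFunc F) (KInf F))

/-- The embedding of `A = 𝔽_q[T]` in `ℂ_∞`. -/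
def embA : F[X] →+* CInf F := embK.comp (algebraMap F[X] (RatFunc F))

/-! ### The Drinfeld upper half-plane -/

variable (F) in
/-- The Drinfeld upper half-plane `Ω = ℙ¹(ℂ_∞) ∖ ℙ¹(K_∞) = ℂ_∞ ∖ K_∞`. -/
def Omega : Type _ := {z : CInf F // z ∉ Set.range (algebraMap (KInf F) (CInf F))}

instance : CoeOut (Omega F) (CInf F) := ⟨Subtype.val⟩

/-- The imaginary part `|z|_i = inf {|z - x| : x ∈ K_∞}`. -/
def imAbs (z : Omega F) : ℝ :=
  Metric.infDist (z : CInf F) (Set.range (algebraMap (KInf F) (CInf F)))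

/-- The affinoid `Ω_n = {z ∈ Ω : |z| ≤ q ^ n, |z|_i ≥ q ^ (-n)}`. The sets `Ω_n` form the usual
admissible covering of `Ω`. -/
def OmegaAff (n : ℕ) : Set (Omega F) :=
  {z | ‖(z : CInf F)‖ ≤ (Fintype.card F : ℝ) ^ n ∧ ((Fintype.card F : ℝ) ^ n)⁻¹ ≤ imAbs z}

/-- `f : Ω → ℂ_∞` is rigid analytic: on each affinoid `Ω_n` it is a uniform limit of rational
functions without poles in `Ω_n`. -/
def IsRigidAnalytic (f : Omega F → CInf F) : Prop :=
  ∀ n : ℕ, ∀ ε : ℝ, 0 < ε → ∃ P Q : (CInf F)[X],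
    (∀ z ∈ OmegaAff (F := F) n, Q.eval (z : CInf F) ≠ 0) ∧
      ∀ z ∈ OmegaAff (F := F) n, ‖f z - P.eval (z : CInf F) / Q.eval (z : CInf F)‖ ≤ ε

/-- `f` is `I`-periodic for some nonzero ideal `I` of `A`. -/
def IsPeriodic (f : Omega F → CInf F) : Prop :=
  ∃ I : Ideal F[X], I ≠ ⊥ ∧ ∀ a ∈ I, ∀ z w : Omega F,
    (w : CInf F) = (z : CInf F) + embA a → f w = f z

/-- `f` belongs to the ring `𝒪` of rigid analytic functions on `Ω` that are `I`-periodic for some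
nonzero ideal `I` of `A`. -/
def MemO (f : Omega F → CInf F) : Prop := IsRigidAnalytic f ∧ IsPeriodic f

/-! ### The action of `GL₂(K)` -/

/-- `c z + d` for `γ = (a b; c d)`. -/
def denom (γ : GL (Fin 2) (RatFunc F)) (z : Omega F) : CInf F :=
  embK (γ 1 0) * (z : CInf F) + embK (γ 1 1)

theorem embK_det_ne_zero (γ : GL (Fin 2) (RatFunc F)) :
    embK (γ 0 0) * embK (γ 1 1) - embK (γ 0 1) * embK (γ 1 0) ≠ (0 : CInf F) := by
  have h : (γ : Matrix (Fin 2) (Fin 2) (RatFunc F)).det ≠ 0 :=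
    ((Matrix.isUnit_iff_isUnit_det _).1 γ.isUnit).ne_zero
  rw [Matrix.det_fin_two] at h
  rw [← map_mul, ← map_mul, ← map_sub]
  exact fun h0 => h ((map_eq_zero embK).1 h0)

theorem eq_zero_of_mul_mem {r s : KInf F} (z : Omega F)
    (h : algebraMap (KInf F) (CInf F) r * (z : CInf F) = algebraMap (KInf F) (CInf F) s) :
    r = 0 := by
  by_contra hr
  refine z.2 ⟨s / r, ?_⟩
  rw [map_div₀, ← h, mul_div_cancel_left₀]
  exact (_root_.map_ne_zero _).2 hr

theorem denom_ne_zero (γ : GL (Fin 2) (RatFunc F)) (z : Omega F) : denom γ z ≠ 0 := by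
  intro h
  have hd := embK_det_ne_zero γ
  have hc : algebraMap (RatFunc F) (KInf F) (γ 1 0) = 0 := by
    refine eq_zero_of_mul_mem (s := - algebraMap (RatFunc F) (KInf F) (γ 1 1)) z ?_
    rw [map_neg]
    exact eq_neg_of_add_eq_zero_left h
  have hc' : embK (γ 1 0) = (0 : CInf F) := by simp [embK, hc]
  have hd' : embK (γ 1 1) = (0 : CInf F) := by simpa [denom, hc'] using h
  exact hd (by rw [hc', hd']; ring)

/-- The action of `GL₂(K)` on `Ω` by fractional linear transformations
`γ z = (a z + b) / (c z + d)`. -/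
def mob (γ : GL (Fin 2) (RatFunc F)) (z : Omega F) : Omega F :=
  ⟨(embK (γ 0 0) * (z : CInf F) + embK (γ 0 1)) / denom γ z, by
    rintro ⟨x, hx⟩
    rw [eq_div_iff (denom_ne_zero γ z), denom] at hx
    have hd := embK_det_ne_zero γ
    have key : algebraMap (KInf F) (CInf F)
        (algebraMap (RatFunc F) (KInf F) (γ 0 0) - x * algebraMap (RatFunc F) (KInf F) (γ 1 0)) *
          (z : CInf F) = algebraMap (KInf F) (CInf F)
        (x * algebraMap (RatFunc F) (KInf F) (γ 1 1) - algebraMap (RatFunc F) (KInf F) (γ 0 1)) := by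
      simp only [map_sub, map_mul]
      simp only [embK, RingHom.comp_apply] at hx
      linear_combination -hx
    have h0 := eq_zero_of_mul_mem z key
    rw [h0, map_zero, zero_mul] at key
    have h1 := congrArg (algebraMap (KInf F) (CInf F)) h0
    simp only [map_sub, map_mul, map_zero] at h1 key
    simp only [embK, RingHom.comp_apply] at hd
    apply hd
    linear_combination (algebraMap (KInf F) (CInf F)
      (algebraMap (RatFunc F) (KInf F) (γ 1 1))) * h1 + (algebraMap (KInf F) (CInf F)
      (algebraMap (RatFunc F) (KInf F) (γ 1 0))) * (-key)⟩

/-- `c / (c z + d)` for `γ = (a b; c d)`. -/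
def kappa (γ : GL (Fin 2) (RatFunc F)) (z : Omega F) : CInf F :=
  embK (γ 1 0) / denom γ z

/-- The slash operator `(f |_{k,m} γ)(z) = (det γ)^m (c z + d)^{-k} f(γ z)`. -/
def slash (k m : ℤ) (f : Omega F → CInf F) (γ : GL (Fin 2) (RatFunc F)) : Omega F → CInf F :=
  fun z => embK (γ : Matrix (Fin 2) (Fin 2) (RatFunc F)).det ^ m * denom γ z ^ (-k) * f (mob γ z)

/-- The Hecke congruence subgroup `Γ₀(𝔪) = {(a b; c d) ∈ GL₂(A) : c ∈ 𝔪}`, inside `GL₂(A)`. -/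
def Gamma0A (𝔪 : Ideal F[X]) : Subgroup (GL (Fin 2) F[X]) where
  carrier := {γ | γ 1 0 ∈ 𝔪}
  one_mem' := by simp
  mul_mem' := by
    intro a b ha hb
    simp only [Set.mem_ofPred_eq, Units.val_mul, Matrix.mul_apply, Fin.sum_univ_two] at *
    exact 𝔪.add_mem (𝔪.mul_mem_right _ ha) (𝔪.mul_mem_left _ hb)
  inv_mem' := by
    intro a ha
    simp only [Set.mem_ofPred_eq] at *
    rw [Matrix.coe_units_inv, Matrix.inv_def, Matrix.adjugate_fin_two]
    simp only [Matrix.smul_apply, Matrix.of_apply, Matrix.cons_val', Matrix.cons_val_zero,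
      Matrix.cons_val_one, Matrix.cons_val_fin_one, smul_eq_mul]
    exact 𝔪.mul_mem_left _ (𝔪.neg_mem ha)

/-- The Hecke congruence subgroup `Γ₀(𝔪)` as a subgroup of `GL₂(K)`. -/
def Gamma0 (𝔪 : Ideal F[X]) : Subgroup (GL (Fin 2) (RatFunc F)) :=
  (Gamma0A 𝔪).map (Matrix.GeneralLinearGroup.map (algebraMap F[X] (RatFunc F)))

/-! ### Quasi-modular forms -/

/-- `P = ∑ f_i X^i ∈ 𝒪[X]` is an associated polynomial of the function `f`, of weight `k` and type
`m` for `Γ`: `(f |_{k,m} γ)(z) = ∑ f_i(z) (c / (c z + d))^i` for all `γ = (a b; c d) ∈ Γ`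
and all `z ∈ Ω`. -/
def IsAssocPoly (Γ : Subgroup (GL (Fin 2) (RatFunc F))) (k m : ℤ) (f : Omega F → CInf F)
    (P : (Omega F → CInf F)[X]) : Prop :=
  (∀ i, MemO (P.coeff i)) ∧
    ∀ γ ∈ Γ, ∀ z, slash k m f γ z =
      ∑ i ∈ Finset.range (P.natDegree + 1), P.coeff i z * kappa γ z ^ i

/-- The associated polynomial `P_f` of `f` (and `0` if there is none). -/
def assocPoly (Γ : Subgroup (GL (Fin 2) (RatFunc F))) (k m : ℤ) (f : Omega F → CInf F) :
    (Omega F → CInf F)[X] :=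
  open Classical in if h : ∃ P, IsAssocPoly Γ k m f P then h.choose else 0

/-- `f` is bounded on vertical lines: `|f(z)|` is bounded as `|z|_i → ∞`. -/
def BoundedOnVerticalLines (f : Omega F → CInf F) : Prop :=
  ∃ B R : ℝ, ∀ z : Omega F, R ≤ imAbs z → ‖f z‖ ≤ B

/-- `f ∈ M̃_{k,m}^{≤ ℓ}(Γ)`: `f` is a Drinfeld quasi-modular form of weight `k`, type `m` and depth
at most `ℓ` for `Γ`. -/
def IsQuasiModularForm (Γ : Subgroup (GL (Fin 2) (RatFunc F))) (k m : ℤ) (ℓ : ℕ)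
    (f : Omega F → CInf F) : Prop :=
  IsRigidAnalytic f ∧ ∃ P : (Omega F → CInf F)[X], IsAssocPoly Γ k m f P ∧ P.natDegree ≤ ℓ ∧
    ∀ i : ℕ, ∀ γ : GL (Fin 2) (RatFunc F),
      BoundedOnVerticalLines (slash (k - 2 * i) (m - i) (P.coeff i) γ)

/-- `f ∈ M_{k,m}(Γ)`: `f` is a Drinfeld modular form of weight `k` and type `m` for `Γ`, that is, a
quasi-modular form of depth `0`. -/
def IsModularForm (Γ : Subgroup (GL (Fin 2) (RatFunc F))) (k m : ℤ) (f : Omega F → CInf F) :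
    Prop :=
  IsQuasiModularForm Γ k m 0 f

/-- The double-slash operator on a quasi-modular form `f` with associated polynomial
`P_f = ∑ f_i X^i`:
`(f ‖_{k,m} γ)(z) = ∑ (-c / (c z + d))^i (f_i |_{k-2i,m-i} γ)(z)`. -/
def doubleSlash (Γ : Subgroup (GL (Fin 2) (RatFunc F))) (k m : ℤ) (f : Omega F → CInf F)
    (γ : GL (Fin 2) (RatFunc F)) : Omega F → CInf F :=
  fun z => ∑ i ∈ Finset.range ((assocPoly Γ k m f).natDegree + 1),
    (-kappa γ z) ^ i * slash (k - 2 * i) (m - i) ((assocPoly Γ k m f).coeff i) γ z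

/-! ### Hecke operators -/

/-- `R` is a finite set of representatives for the orbit space `Γ \ Γ η Γ`. -/
def IsCosetReps (Γ : Subgroup (GL (Fin 2) (RatFunc F))) (η : GL (Fin 2) (RatFunc F))
    (R : Finset (GL (Fin 2) (RatFunc F))) : Prop :=
  (∀ r ∈ R, r ∈ DoubleCoset.doubleCoset η (Γ : Set (GL (Fin 2) (RatFunc F))) Γ) ∧
    ∀ δ ∈ DoubleCoset.doubleCoset η (Γ : Set (GL (Fin 2) (RatFunc F))) Γ,
      ∃! r, r ∈ R ∧ δ * r⁻¹ ∈ Γ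

/-- The Hecke operator `T_η(f) = (det η)^{k-m} ∑_γ f ‖_{k,m} γ` in weight `k` and type `m`, where
`γ` runs over a set `R` of representatives for `Γ \ Γ η Γ`. -/
def hecke (Γ : Subgroup (GL (Fin 2) (RatFunc F))) (η : GL (Fin 2) (RatFunc F))
    (R : Finset (GL (Fin 2) (RatFunc F))) (k m : ℤ) (f : Omega F → CInf F) : Omega F → CInf F :=
  fun z => embK (η : Matrix (Fin 2) (Fin 2) (RatFunc F)).det ^ (k - m) *
    ∑ γ ∈ R, doubleSlash Γ k m f γ z

/-- The diagonal matrix `(a 0; 0 d)` in `GL₂(K)`, for nonzero `a, d ∈ A`. -/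
def diagGL (a d : F[X]) (ha : a ≠ 0) (hd : d ≠ 0) : GL (Fin 2) (RatFunc F) :=
  Matrix.GeneralLinearGroup.mkOfDetNeZero
    !![algebraMap F[X] (RatFunc F) a, 0; 0, algebraMap F[X] (RatFunc F) d]
    (by
      rw [Matrix.det_fin_two_of, mul_zero, sub_zero]
      exact mul_ne_zero ((map_ne_zero_iff _ (RatFunc.algebraMap_injective F)).2 ha)
        ((map_ne_zero_iff _ (RatFunc.algebraMap_injective F)).2 hd))

/-- The matrix `(1 0; 0 ϖ)` defining the Hecke operators `T_𝔭` and `U_𝔭` for `𝔭 = (ϖ)`. -/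
def heckeMat (ϖ : F[X]) (h : ϖ ≠ 0) : GL (Fin 2) (RatFunc F) := diagGL 1 ϖ one_ne_zero h

/-- The degeneracy map `(δ_𝔭 f)(z) = f(ϖ z)` for `𝔭 = (ϖ)`; here `ϖ z` is the image of `z` under
the matrix `(ϖ 0; 0 1)`. -/
def degeneracy (ϖ : F[X]) (h : ϖ ≠ 0) (f : Omega F → CInf F) : Omega F → CInf F :=
  fun z => f (mob (diagGL ϖ 1 h one_ne_zero) z)

/-! ### The false Eisenstein series and `E`-expansions -/

/-- `D_i = ∏_{j < i} (T^{q^i} - T^{q^j})`. -/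
def carlitzD (F : Type*) [Field F] [Fintype F] (i : ℕ) : F[X] :=
  ∏ j ∈ Finset.range i, (X ^ Fintype.card F ^ i - X ^ Fintype.card F ^ j)

/-- The Carlitz exponential `e_C(z) = ∑_{i ≥ 0} z^{q^i} / D_i`, the exponential function of the
Carlitz module `C_T = T τ^0 + τ`. -/
def carlitzExp (z : CInf F) : CInf F :=
  ∑' i : ℕ, z ^ Fintype.card F ^ i / embA (carlitzD F i)

/-- `π` is a period of the Carlitz module: a basis of the free rank one `A`-module of zeros of the
Carlitz exponential. -/
def IsCarlitzPeriod (π : CInf F) : Prop :=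
  π ≠ 0 ∧ ∀ z : CInf F, carlitzExp z = 0 ↔ ∃ a : F[X], z = π * embA a

/-- The false Eisenstein series
`E(z) = π⁻¹ ∑_{a ∈ A monic} ∑_{b ∈ A} a / (a z + b)`. -/
def falseE (π : CInf F) : Omega F → CInf F :=
  fun z => π⁻¹ * ∑' a : {a : F[X] // a.Monic}, ∑' b : F[X],
    embA a.1 / (embA a.1 * (z : CInf F) + embA b)

/-- The `𝔭`-stabilization `E_𝔭 = E - ϖ δ_𝔭 E` of `E`, for `𝔭 = (ϖ)`. -/
def stabE (π : CInf F) (ϖ : F[X]) (h : ϖ ≠ 0) : Omega F → CInf F :=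
  fun z => falseE π z - embA ϖ * degeneracy ϖ h (falseE π) z

/-- The coefficient `f_{i,E} = (-π)^i ∑_{h ≥ i} (h choose i) f_h (π E)^{h-i}` of the `E`-expansion
of a quasi-modular form `f` with associated polynomial `P_f = ∑ f_h X^h`. -/
def eCoeff (π : CInf F) (Γ : Subgroup (GL (Fin 2) (RatFunc F))) (k m : ℤ) (f : Omega F → CInf F)
    (i : ℕ) : Omega F → CInf F :=
  fun z => (-π) ^ i * ∑ h ∈ Finset.Icc i (assocPoly Γ k m f).natDegree,
    (h.choose i : CInf F) * (assocPoly Γ k m f).coeff h z * (π * falseE π z) ^ (h - i)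

/-- `f ∈ M̃_{k,m}^{≤ ℓ}(Γ)` has the `E`-expansion `f = ∑_{i ≤ ℓ} c_i E^i`. The coefficients
`c_i` are the functions `f_{i,E}`, and they are modular forms in `M_{k-2i,m-i}(Γ)`. -/
structure HasEExpansion (π : CInf F) (Γ : Subgroup (GL (Fin 2) (RatFunc F))) (k m : ℤ) (ℓ : ℕ)
    (f : Omega F → CInf F) (c : ℕ → Omega F → CInf F) : Prop where
  isQuasiModularForm : IsQuasiModularForm Γ k m ℓ f
  coeff_eq : ∀ i ≤ ℓ, c i = eCoeff π Γ k m f i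
  coeff_isModularForm : ∀ i ≤ ℓ, IsModularForm Γ (k - 2 * i) (m - i) (c i)
  eq_sum : ∀ z, f z = ∑ i ∈ Finset.range (ℓ + 1), c i z * falseE π z ^ i

end

end DrinfeldQM

end

open DrinfeldQM

/-!
Under the double slash action `E ‖ γ = E |_{2,1} γ + π⁻¹ c / (c z + d)` the false Eisenstein series
is fixed by `GL₂(A)`: by the Euclidean algorithm this group is generated by translations, diagonal
matrices and the inversion, and for the inversion it is a rearrangement of a conditionally
convergent lattice sum. Hence `f E^n` is quasi-modular with associated polynomial
`f (E - π⁻¹ X)^n` and `(f E^n) ‖ γ = (f | γ) (E ‖ γ)^n` for every `γ ∈ GL₂(K)`.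

Expanding `(E ‖ γ)^n = (E + (E ‖ γ - E))^n` writes `T_𝔭 (f E^n)` as a polynomial in `E`. Its
coefficients are sums of `(f | γ) (E ‖ γ - E)^(n - h)` over `Γ \ Γ η Γ`; right translation by `Γ`
permutes the summands, so they are modular forms, and uniqueness of the associated polynomial makes
them the coefficients of the `E`-expansion. Representatives for `T_𝔭` are those for `U_𝔭` together
with `diag(ϖ, 1)`. For the latter `E ‖ γ - E = -E_𝔭`, while for the former `E ‖ γ - E = E_𝔭 | γ`,
which gives the term with `δ_𝔭 f` and the term `U_𝔭 (f E_𝔭^(n - h))`.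
-/

noncomputable section

namespace DrinfeldQM

/-! ### Bounds on rational functions over a complete ultrametric field -/

section Ultrametric

theorem exists_le_norm_prod_sub {L : Type*} [NormedField L] {S : Set L} (hS : IsClosed S)
    (s : Multiset L) (hs : ∀ r ∈ s, r ∉ S) :
    ∃ c > 0, ∀ z ∈ S, c ≤ ‖(s.map fun r => z - r).prod‖ := by
  induction s using Multiset.induction_on with
  | empty => exact ⟨1, one_pos, by simp⟩
  | cons r s ih =>
    obtain ⟨c, hc, hcs⟩ := ih fun t ht => hs t (Multiset.mem_cons_of_mem ht)
    obtain ⟨d, hd, hdS⟩ := Metric.isOpen_iff.1 hS.isOpen_compl r (hs r (Multiset.mem_cons_self r s))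
    refine ⟨d * c, mul_pos hd hc, fun z hz => ?_⟩
    have hdr : d ≤ ‖z - r‖ := by
      by_contra! h
      exact hdS (mem_ball_iff_norm.2 h) hz
    rw [Multiset.map_cons, Multiset.prod_cons, norm_mul]
    exact mul_le_mul hdr (hcs z hz) hc.le (norm_nonneg _)

/-- Over the splitting field of `Q`, the values of `Q` become products of distances to the roots,
which stay away from the closed image of `S`. -/
theorem exists_le_norm_eval {k : Type*} [NontriviallyNormedField k] [CompleteSpace k]
    [IsUltrametricDist k] {S : Set k} (hS : IsClosed S) (Q : k[X])
    (hQ : ∀ z ∈ S, Q.eval z ≠ 0) : ∃ c > 0, ∀ z ∈ S, c ≤ ‖Q.eval z‖ := by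
  rcases eq_or_ne Q 0 with rfl | hQ0
  · exact ⟨1, one_pos, fun z hz => absurd eval_zero (hQ z hz)⟩
  let L := Q.SplittingField
  let _ : NormedField L := spectralNorm.normedField k L
  let _ : NormedAlgebra k L := spectralNorm.normedAlgebra k L
  have hclosed : IsClosed (algebraMap k L '' S) :=
    (algebraMap_isometry k L).isClosedEmbedding.isClosedMap S hS
  have heval (z : k) : algebraMap k L (Q.eval z) = algebraMap k L Q.leadingCoeff *
      ((Q.map (algebraMap k L)).roots.map fun r => algebraMap k L z - r).prod := by
    have h := (SplittingField.splits Q).eval_eq_prod_roots (algebraMap k L z)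
    rwa [eval_map_algebraMap, aeval_algebraMap_apply_eq_algebraMap_eval, leadingCoeff_map] at h
  have hroots : ∀ r ∈ (Q.map (algebraMap k L)).roots, r ∉ algebraMap k L '' S := by
    rintro _ hr ⟨z, hz, rfl⟩
    have h := (mem_roots'.1 hr).2
    rw [IsRoot.def, eval_map_algebraMap, aeval_algebraMap_apply_eq_algebraMap_eval] at h
    exact hQ z hz ((map_eq_zero _).1 h)
  obtain ⟨c, hc, hcS⟩ := exists_le_norm_prod_sub hclosed _ hroots
  refine ⟨‖Q.leadingCoeff‖ * c, mul_pos (norm_pos_iff.2 (leadingCoeff_ne_zero.2 hQ0)) hc,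
    fun z hz => ?_⟩
  rw [← norm_algebraMap' L (Q.eval z), heval, norm_mul, norm_algebraMap']
  gcongr
  exact hcS _ ⟨z, hz, rfl⟩

theorem norm_sub_le_max {E : Type*} [SeminormedAddCommGroup E] [IsUltrametricDist E] (x y : E) :
    ‖x - y‖ ≤ max ‖x‖ ‖y‖ := by
  simpa only [sub_eq_add_neg, norm_neg] using IsUltrametricDist.norm_add_le_max x (-y)

end Ultrametric

variable {F : Type*} [Field F]

section

variable [Fintype F]

/-! ### Absolute values and imaginary parts -/

instance instUltraCInf : IsUltrametricDist (CInf F) := by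
  rw [isUltrametricDist_iff_forall_norm_natCast_le_one]
  intro n
  rw [← map_natCast (algebraMap (KInf F) (CInf F)) n, norm_algebraMap']
  exact IsUltrametricDist.norm_natCast_le_one (KInf F) n

theorem one_lt_card (α : Type*) [Fintype α] [Nontrivial α] : (1 : ℝ) < Fintype.card α := by
  exact_mod_cast Fintype.one_lt_card

theorem card_pos (α : Type*) [Fintype α] [Nonempty α] : (0 : ℝ) < Fintype.card α := by
  exact_mod_cast Fintype.card_pos

theorem norm_embA {a : F[X]} (ha : a ≠ 0) :
    ‖(embA a : CInf F)‖ = (Fintype.card F : ℝ) ^ a.natDegree := by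
  have h : algebraMap F[X] (RatFunc F) a ≠ 0 := RatFunc.algebraMap_ne_zero ha
  rw [embA, embK, RingHom.comp_apply, RingHom.comp_apply, norm_algebraMap',
    norm_KInf_algebraMap F _ h, RatFunc.intDegree_polynomial, zpow_natCast]

instance instNontriviallyNormedFieldCInf : NontriviallyNormedField (CInf F) where
  non_trivial := ⟨embA X, by simpa [norm_embA] using one_lt_card F⟩

theorem embA_injective : Function.Injective (embA : F[X] → CInf F) :=
  (RingHom.injective (embK (F := F))).comp (RatFunc.algebraMap_injective F)

theorem embA_ne_zero {a : F[X]} (ha : a ≠ 0) : (embA a : CInf F) ≠ 0 :=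
  (map_ne_zero_iff _ embA_injective).2 ha

theorem imAbs_pos (z : Omega F) : 0 < imAbs z :=
  ((algebraMap_isometry (KInf F) (CInf F)).isClosedEmbedding.isClosed_range.notMem_iff_infDist_pos
    (Set.range_nonempty _)).1 z.2

theorem imAbs_le_norm_sub (z : Omega F) (x : KInf F) :
    imAbs z ≤ ‖(z : CInf F) - algebraMap (KInf F) (CInf F) x‖ := by
  rw [← dist_eq_norm]
  exact Metric.infDist_le_dist_of_mem ⟨x, rfl⟩

theorem le_imAbs {z : Omega F} {c : ℝ}
    (h : ∀ x : KInf F, c ≤ ‖(z : CInf F) - algebraMap (KInf F) (CInf F) x‖) : c ≤ imAbs z := by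
  refine (Metric.le_infDist (Set.range_nonempty _)).2 ?_
  rintro _ ⟨x, rfl⟩
  exact (h x).trans_eq (dist_eq_norm _ _).symm

theorem imAbs_le_norm (z : Omega F) : imAbs z ≤ ‖(z : CInf F)‖ := by
  simpa using imAbs_le_norm_sub z 0

theorem Omega.ne_zero (z : Omega F) : (z : CInf F) ≠ 0 :=
  norm_pos_iff.1 ((imAbs_pos z).trans_le (imAbs_le_norm z))

theorem norm_mul_imAbs_le (z : Omega F) (u v : KInf F) :
    ‖u‖ * imAbs z ≤ ‖algebraMap (KInf F) (CInf F) u * z + algebraMap (KInf F) (CInf F) v‖ := by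
  rcases eq_or_ne u 0 with rfl | hu
  · simp
  have hfactor : algebraMap (KInf F) (CInf F) u * z + algebraMap (KInf F) (CInf F) v =
      algebraMap (KInf F) (CInf F) u * (z - algebraMap (KInf F) (CInf F) (-v / u)) := by
    have hu' : algebraMap (KInf F) (CInf F) u ≠ 0 := (_root_.map_ne_zero _).2 hu
    rw [map_div₀, map_neg]
    field_simp
    ring
  rw [hfactor, norm_mul, norm_algebraMap']
  gcongr
  exact imAbs_le_norm_sub z _

theorem norm_embK_mul_imAbs_le (z : Omega F) (r s : RatFunc F) :
    ‖(embK r : CInf F)‖ * imAbs z ≤ ‖embK r * (z : CInf F) + embK s‖ := by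
  have h := norm_mul_imAbs_le z (algebraMap _ (KInf F) r) (algebraMap _ (KInf F) s)
  rwa [← norm_algebraMap' (CInf F)] at h

theorem norm_embA_mul_imAbs_le (z : Omega F) (a b : F[X]) :
    ‖(embA a : CInf F)‖ * imAbs z ≤ ‖embA a * (z : CInf F) + embA b‖ :=
  norm_embK_mul_imAbs_le z (algebraMap _ _ a) (algebraMap _ _ b)

theorem embA_mul_add_ne_zero (z : Omega F) {a : F[X]} (ha : a ≠ 0) (b : F[X]) :
    embA a * (z : CInf F) + embA b ≠ 0 :=
  norm_pos_iff.1 <| (mul_pos (norm_pos_iff.2 (embA_ne_zero ha)) (imAbs_pos z)).trans_le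
    (norm_embA_mul_imAbs_le z a b)

/-! ### Fractional linear transformations and the slash operator -/

theorem coe_mob (γ : GL (Fin 2) (RatFunc F)) (z : Omega F) :
    (mob γ z : CInf F) = (embK (γ 0 0) * (z : CInf F) + embK (γ 0 1)) / denom γ z := rfl

theorem denom_mul (γ δ : GL (Fin 2) (RatFunc F)) (z : Omega F) :
    denom (γ * δ) z = denom γ (mob δ z) * denom δ z := by
  have h := denom_ne_zero δ z
  rw [denom, denom, coe_mob]
  simp only [Units.val_mul, Matrix.mul_apply, Fin.sum_univ_two, map_add, map_mul]
  field_simp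
  rw [denom]
  ring

theorem mob_mul (γ δ : GL (Fin 2) (RatFunc F)) (z : Omega F) :
    mob (γ * δ) z = mob γ (mob δ z) := by
  apply Subtype.ext
  have h := denom_ne_zero δ z
  have h' := denom_ne_zero γ (mob δ z)
  rw [coe_mob, coe_mob, denom_mul, div_eq_div_iff (mul_ne_zero h' h) h', coe_mob]
  simp only [Units.val_mul, Matrix.mul_apply, Fin.sum_univ_two, map_add, map_mul]
  field_simp
  rw [denom]
  ring

theorem denom_one (z : Omega F) : denom 1 z = 1 := by simp [denom]

theorem mob_one (z : Omega F) : mob 1 z = z := by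
  apply Subtype.ext
  simp [coe_mob, denom_one]

/-- The determinant of a matrix in `GL₂(K)`, as an element of `ℂ_∞`. -/
def detC (γ : GL (Fin 2) (RatFunc F)) : CInf F :=
  embK (γ : Matrix (Fin 2) (Fin 2) (RatFunc F)).det

theorem detC_eq (γ : GL (Fin 2) (RatFunc F)) :
    detC γ = embK (γ 0 0) * embK (γ 1 1) - embK (γ 0 1) * embK (γ 1 0) := by
  simp [detC, Matrix.det_fin_two]

theorem detC_ne_zero (γ : GL (Fin 2) (RatFunc F)) : detC γ ≠ 0 := by
  rw [detC_eq]
  exact embK_det_ne_zero γ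

theorem detC_mul (γ δ : GL (Fin 2) (RatFunc F)) : detC (γ * δ) = detC γ * detC δ := by
  simp [detC]

theorem detC_one : detC (1 : GL (Fin 2) (RatFunc F)) = 1 := by simp [detC]

theorem norm_embK_mul_imAbs_le_norm_denom (γ : GL (Fin 2) (RatFunc F)) (z : Omega F) :
    ‖(embK (γ 1 0) : CInf F)‖ * imAbs z ≤ ‖denom γ z‖ :=
  norm_embK_mul_imAbs_le z _ _

theorem norm_kappa_mul_imAbs_le_one (γ : GL (Fin 2) (RatFunc F)) (z : Omega F) :
    ‖kappa γ z‖ * imAbs z ≤ 1 := by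
  rw [kappa, norm_div, div_mul_eq_mul_div]
  exact div_le_one_of_le₀ (norm_embK_mul_imAbs_le_norm_denom γ z) (norm_nonneg _)

/-- For `γ = (a b; c d)` and `x ∈ K_∞` put `u = a - x c` and `w = u z + (b - x d)`, so that
`γ z - x = w / (c z + d)`. Then `det γ = u (c z + d) - c w`, while `|u| |z|_i ≤ |w|` and
`|c| |z|_i ≤ |c z + d|`. -/
theorem norm_detC_mul_imAbs_le (γ : GL (Fin 2) (RatFunc F)) (z : Omega F) :
    ‖detC γ‖ * imAbs z ≤ imAbs (mob γ z) * ‖denom γ z‖ ^ 2 := by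
  have hden : 0 < ‖denom γ z‖ := norm_pos_iff.2 (denom_ne_zero γ z)
  rw [← div_le_iff₀ (pow_pos hden 2)]
  refine le_imAbs fun x => ?_
  set u : CInf F := embK (γ 0 0) - algebraMap _ _ x * embK (γ 1 0) with hu
  set w : CInf F := u * z + (embK (γ 0 1) - algebraMap _ _ x * embK (γ 1 1)) with hw
  have hmob : (mob γ z : CInf F) - algebraMap _ _ x = w / denom γ z := by
    rw [coe_mob, eq_div_iff (denom_ne_zero γ z), sub_mul, div_mul_cancel₀ _ (denom_ne_zero γ z)]
    simp only [hw, hu, denom]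
    ring
  have hdet : detC γ = u * denom γ z - embK (γ 1 0) * w := by
    simp only [detC_eq, hw, hu, denom]
    ring
  have hu_le : ‖u‖ * imAbs z ≤ ‖w‖ := by
    have h := norm_mul_imAbs_le z (algebraMap _ (KInf F) (γ 0 0) - x * algebraMap _ _ (γ 1 0))
      (algebraMap _ (KInf F) (γ 0 1) - x * algebraMap _ _ (γ 1 1))
    rw [← norm_algebraMap' (CInf F)] at h
    simp only [map_sub, map_mul] at h
    exact h
  rw [hmob, norm_div, div_le_div_iff₀ (pow_pos hden 2) hden, pow_two, ← mul_assoc]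
  refine mul_le_mul_of_nonneg_right ?_ hden.le
  calc ‖detC γ‖ * imAbs z
      ≤ max (‖u‖ * ‖denom γ z‖) (‖(embK (γ 1 0) : CInf F)‖ * ‖w‖) * imAbs z := by
        rw [hdet, ← norm_mul, ← norm_mul]
        gcongr
        · exact (imAbs_pos z).le
        · exact norm_sub_le_max _ _
    _ = max (‖u‖ * imAbs z * ‖denom γ z‖) (‖w‖ * (‖(embK (γ 1 0) : CInf F)‖ * imAbs z)) := by
        rw [max_mul_of_nonneg _ _ (imAbs_pos z).le]
        ring_nf
    _ ≤ ‖w‖ * ‖denom γ z‖ :=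
        max_le (by gcongr) (by gcongr; exact norm_embK_mul_imAbs_le_norm_denom γ z)

theorem slash_apply (k m : ℤ) (f : Omega F → CInf F) (γ : GL (Fin 2) (RatFunc F)) (z : Omega F) :
    slash k m f γ z = detC γ ^ m * denom γ z ^ (-k) * f (mob γ z) := rfl

theorem slash_one (k m : ℤ) (f : Omega F → CInf F) : slash k m f 1 = f := by
  ext z
  simp [slash_apply, detC_one, denom_one, mob_one]

theorem slash_mul (k m : ℤ) (f : Omega F → CInf F) (γ δ : GL (Fin 2) (RatFunc F)) :
    slash k m f (γ * δ) = slash k m (slash k m f γ) δ := by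
  ext z
  simp only [slash_apply, detC_mul, denom_mul, mob_mul, mul_zpow]
  ring

theorem mul_slash (k m k' m' : ℤ) (f g : Omega F → CInf F) (γ : GL (Fin 2) (RatFunc F)) :
    slash (k + k') (m + m') (f * g) γ = slash k m f γ * slash k' m' g γ := by
  ext z
  simp only [slash_apply, Pi.mul_apply]
  rw [neg_add, zpow_add₀ (detC_ne_zero γ), zpow_add₀ (denom_ne_zero γ z)]
  ring

theorem pow_slash (k m : ℤ) (f : Omega F → CInf F) (n : ℕ) (γ : GL (Fin 2) (RatFunc F)) :
    slash (n * k) (n * m) (f ^ n) γ = slash k m f γ ^ n := by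
  ext z
  simp only [slash_apply, Pi.pow_apply, mul_pow]
  rw [← zpow_natCast (detC γ ^ m), ← zpow_natCast (denom γ z ^ (-k)), ← zpow_mul, ← zpow_mul,
    mul_comm m, neg_mul, mul_comm k]

theorem mul_pow_slash (k m k' m' : ℤ) (f g : Omega F → CInf F) (n : ℕ)
    (γ : GL (Fin 2) (RatFunc F)) :
    slash k m (f * g ^ n) γ =
      slash (k - n * k') (m - n * m') f γ * slash k' m' g γ ^ n := by
  rw [← pow_slash, ← mul_slash, sub_add_cancel, sub_add_cancel]

theorem smul_slash (k m : ℤ) (c : CInf F) (f : Omega F → CInf F) (γ : GL (Fin 2) (RatFunc F)) :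
    slash k m (c • f) γ = c • slash k m f γ := by
  ext z
  simp only [slash_apply, Pi.smul_apply, smul_eq_mul]
  ring

theorem add_slash (k m : ℤ) (f g : Omega F → CInf F) (γ : GL (Fin 2) (RatFunc F)) :
    slash k m (f + g) γ = slash k m f γ + slash k m g γ := by
  ext z
  exact mul_add _ _ _

theorem sub_slash (k m : ℤ) (f g : Omega F → CInf F) (γ : GL (Fin 2) (RatFunc F)) :
    slash k m (f - g) γ = slash k m f γ - slash k m g γ := by
  ext z
  exact mul_sub _ _ _

theorem sum_slash {ι : Type*} (s : Finset ι) (k m : ℤ) (f : ι → Omega F → CInf F)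
    (γ : GL (Fin 2) (RatFunc F)) :
    slash k m (∑ i ∈ s, f i) γ = ∑ i ∈ s, slash k m (f i) γ := by
  ext z
  simp only [slash_apply, Finset.sum_apply, Finset.mul_sum]

theorem kappa_mul (γ δ : GL (Fin 2) (RatFunc F)) :
    kappa (γ * δ) = slash 2 1 (kappa γ) δ + kappa δ := by
  ext z
  have h := denom_ne_zero δ z
  have h' := denom_ne_zero γ (mob δ z)
  have hden : denom γ (mob δ z) * denom δ z = embK (γ 1 0) * (embK (δ 0 0) * (z : CInf F) +
      embK (δ 0 1)) + embK (γ 1 1) * denom δ z := by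
    rw [denom, coe_mob]
    field_simp
  have hδ : denom δ z = embK (δ 1 0) * (z : CInf F) + embK (δ 1 1) := rfl
  simp only [Pi.add_apply, slash_apply, kappa, denom_mul, detC_eq, zpow_neg, zpow_one, zpow_two,
    Units.val_mul, Matrix.mul_apply, Fin.sum_univ_two, map_add, map_mul]
  field_simp
  linear_combination (-embK (δ 1 0)) * hden + embK (γ 1 0) * embK (δ 0 0) * hδ

/-! ### Rigid analytic functions -/

theorem exists_forall_mem_OmegaAff (B : ℝ) {c : ℝ} (hc : 0 < c) :
    ∃ n, ∀ z : Omega F, ‖(z : CInf F)‖ ≤ B → c ≤ imAbs z → z ∈ OmegaAff n := by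
  obtain ⟨n, hn⟩ := pow_unbounded_of_one_lt (max B c⁻¹) (one_lt_card F)
  refine ⟨n, fun z hB hz => ⟨hB.trans ((le_max_left _ _).trans hn.le), le_trans ?_ hz⟩⟩
  exact inv_le_of_inv_le₀ hc ((le_max_right _ _).trans hn.le)

theorem exists_mem_OmegaAff (z : Omega F) : ∃ n, z ∈ OmegaAff n :=
  (exists_forall_mem_OmegaAff _ (imAbs_pos z)).imp fun _ h => h z le_rfl le_rfl

theorem isClosed_coe_image_OmegaAff (n : ℕ) :
    IsClosed ((fun z : Omega F => (z : CInf F)) '' OmegaAff n) := by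
  have himage : (fun z : Omega F => (z : CInf F)) '' OmegaAff n =
      {x | ‖x‖ ≤ (Fintype.card F : ℝ) ^ n} ∩ {x | ((Fintype.card F : ℝ) ^ n)⁻¹ ≤
        Metric.infDist x (Set.range (algebraMap (KInf F) (CInf F)))} := by
    refine Set.Subset.antisymm (by rintro _ ⟨z, hz, rfl⟩; exact hz) fun x hx => ?_
    refine ⟨⟨x, fun hmem => ?_⟩, hx, rfl⟩
    exact (inv_pos.2 (pow_pos (card_pos F) n)).not_ge
      (hx.2.trans_eq (Metric.infDist_zero_of_mem hmem))
  rw [himage]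
  exact (isClosed_le continuous_norm continuous_const).inter
    (isClosed_le continuous_const (Metric.continuous_infDist_pt _))

/-- The functions on `Ω` that are given on `S` by a rational function without poles in `S`. -/
def rationalOn (S : Set (Omega F)) : Subalgebra (CInf F) (Omega F → CInf F) where
  carrier := {g | ∃ P Q : (CInf F)[X], (∀ z ∈ S, Q.eval (z : CInf F) ≠ 0) ∧
    ∀ z ∈ S, g z = P.eval (z : CInf F) / Q.eval (z : CInf F)}
  mul_mem' := by
    rintro f g ⟨P, Q, hQ, hf⟩ ⟨P', Q', hQ', hg⟩
    refine ⟨P * P', Q * Q', fun z hz => ?_, fun z hz => ?_⟩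
    · rw [eval_mul]
      exact mul_ne_zero (hQ z hz) (hQ' z hz)
    · rw [Pi.mul_apply, hf z hz, hg z hz, div_mul_div_comm, eval_mul, eval_mul]
  add_mem' := by
    rintro f g ⟨P, Q, hQ, hf⟩ ⟨P', Q', hQ', hg⟩
    refine ⟨P * Q' + Q * P', Q * Q', fun z hz => ?_, fun z hz => ?_⟩
    · rw [eval_mul]
      exact mul_ne_zero (hQ z hz) (hQ' z hz)
    · rw [Pi.add_apply, hf z hz, hg z hz, div_add_div _ _ (hQ z hz) (hQ' z hz)]
      simp only [eval_add, eval_mul]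
  algebraMap_mem' c := ⟨C c, 1, by simp, by simp⟩

section rationalOn

variable {S : Set (Omega F)} {f : Omega F → CInf F}

theorem const_mem_rationalOn (c : CInf F) : (fun _ => c) ∈ rationalOn S :=
  (rationalOn S).algebraMap_mem c

theorem coe_mem_rationalOn : (fun z : Omega F => (z : CInf F)) ∈ rationalOn S :=
  ⟨X, 1, by simp, by simp⟩

theorem inv_mem_rationalOn (hf : f ∈ rationalOn S) (h0 : ∀ z ∈ S, f z ≠ 0) :
    f⁻¹ ∈ rationalOn S := by
  obtain ⟨P, Q, -, h⟩ := hf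
  refine ⟨Q, P, fun z hz hP => h0 z hz ?_, fun z hz => ?_⟩
  · rw [h z hz, hP, zero_div]
  · rw [Pi.inv_apply, h z hz, inv_div]

theorem zpow_mem_rationalOn (hf : f ∈ rationalOn S) (h0 : ∀ z ∈ S, f z ≠ 0) :
    ∀ n : ℤ, f ^ n ∈ rationalOn S
  | .ofNat n => by simpa using pow_mem hf n
  | .negSucc n => by
    simpa using inv_mem_rationalOn (pow_mem hf (n + 1)) fun z hz => pow_ne_zero _ (h0 z hz)

theorem eval_mem_rationalOn (hf : f ∈ rationalOn S) (P : (CInf F)[X]) :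
    (fun z => P.eval (f z)) ∈ rationalOn S := by
  have h : aeval f P ∈ rationalOn S := aeval_subalgebra_coe P _ ⟨f, hf⟩ ▸ SetLike.coe_mem _
  simpa only [aeval_pi_apply, coe_aeval_eq_eval] using h

theorem comp_mem_rationalOn {T : Set (Omega F)} {φ : Omega F → Omega F} (hf : f ∈ rationalOn T)
    (hφ : (fun z => (φ z : CInf F)) ∈ rationalOn S) (h : Set.MapsTo φ S T) :
    f ∘ φ ∈ rationalOn S := by
  obtain ⟨P, Q, hQ, hPQ⟩ := hf
  obtain ⟨P', Q', hQ', h'⟩ := mul_mem (eval_mem_rationalOn hφ P)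
    (inv_mem_rationalOn (eval_mem_rationalOn hφ Q) fun z hz => hQ _ (h hz))
  refine ⟨P', Q', hQ', fun z hz => ?_⟩
  rw [← h' z hz, Function.comp_apply, hPQ _ (h hz), div_eq_mul_inv]
  rfl

theorem mul_add_mem_rationalOn (c d : CInf F) :
    (fun z : Omega F => c * (z : CInf F) + d) ∈ rationalOn S :=
  add_mem (mul_mem (const_mem_rationalOn c) coe_mem_rationalOn) (const_mem_rationalOn d)

theorem denom_mem_rationalOn (γ : GL (Fin 2) (RatFunc F)) : denom γ ∈ rationalOn S :=
  mul_add_mem_rationalOn _ _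

theorem inv_denom_mem_rationalOn (γ : GL (Fin 2) (RatFunc F)) : (denom γ)⁻¹ ∈ rationalOn S :=
  inv_mem_rationalOn (denom_mem_rationalOn γ) fun z _ => denom_ne_zero γ z

theorem coe_mob_mem_rationalOn (γ : GL (Fin 2) (RatFunc F)) :
    (fun z => (mob γ z : CInf F)) ∈ rationalOn S := by
  simp only [coe_mob, div_eq_mul_inv]
  exact mul_mem (mul_add_mem_rationalOn _ _) (inv_denom_mem_rationalOn γ)

theorem kappa_mem_rationalOn (γ : GL (Fin 2) (RatFunc F)) : kappa γ ∈ rationalOn S := by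
  simp only [funext (kappa.eq_1 γ), div_eq_mul_inv]
  exact mul_mem (const_mem_rationalOn _) (inv_denom_mem_rationalOn γ)

end rationalOn

theorem exists_norm_le_of_mem_rationalOn {n : ℕ} {g : Omega F → CInf F}
    (hg : g ∈ rationalOn (OmegaAff n)) : ∃ B > 0, ∀ z ∈ OmegaAff n, ‖g z‖ ≤ B := by
  obtain ⟨P, Q, hQ, h⟩ := hg
  obtain ⟨c, hc, hcQ⟩ := exists_le_norm_eval (isClosed_coe_image_OmegaAff n) Q
    (by rintro _ ⟨z, hz, rfl⟩; exact hQ z hz)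
  set M : ℝ := ∑ i ∈ Finset.range (P.natDegree + 1), ‖P.coeff i‖ * ((Fintype.card F : ℝ) ^ n) ^ i
  have hP : ∀ z ∈ OmegaAff (F := F) n, ‖P.eval (z : CInf F)‖ ≤ M := by
    intro z hz
    rw [eval_eq_sum_range]
    refine (norm_sum_le _ _).trans (Finset.sum_le_sum fun i _ => ?_)
    rw [norm_mul, norm_pow]
    gcongr
    exact hz.1
  refine ⟨(M + 1) / c, by positivity, fun z hz => ?_⟩
  rw [h z hz, norm_div]
  gcongr
  · exact (hP z hz).trans (le_add_of_nonneg_right zero_le_one)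
  · exact hcQ _ ⟨z, hz, rfl⟩

theorem exists_mapsTo_OmegaAff (γ : GL (Fin 2) (RatFunc F)) (n : ℕ) :
    ∃ n', Set.MapsTo (mob γ) (OmegaAff n) (OmegaAff n') := by
  obtain ⟨B, -, hB⟩ := exists_norm_le_of_mem_rationalOn (n := n) (coe_mob_mem_rationalOn γ)
  obtain ⟨D, hD, hDn⟩ := exists_norm_le_of_mem_rationalOn (n := n) (denom_mem_rationalOn γ)
  have hdet : 0 < ‖detC γ‖ := norm_pos_iff.2 (detC_ne_zero γ)
  obtain ⟨n', hn'⟩ := exists_forall_mem_OmegaAff (F := F) B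
    (c := ‖detC γ‖ * ((Fintype.card F : ℝ) ^ n)⁻¹ / D ^ 2) (by positivity)
  refine ⟨n', fun z hz => hn' _ (hB z hz) ((div_le_iff₀ (pow_pos hD 2)).2 ?_)⟩
  calc ‖detC γ‖ * ((Fintype.card F : ℝ) ^ n)⁻¹ ≤ ‖detC γ‖ * imAbs z := by gcongr; exact hz.2
    _ ≤ imAbs (mob γ z) * ‖denom γ z‖ ^ 2 := norm_detC_mul_imAbs_le γ z
    _ ≤ imAbs (mob γ z) * D ^ 2 := by
      gcongr
      · exact (imAbs_pos _).le
      · exact hDn z hz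

theorem isRigidAnalytic_iff {f : Omega F → CInf F} :
    IsRigidAnalytic f ↔ ∀ n : ℕ, ∀ ε > 0, ∃ g ∈ rationalOn (OmegaAff n),
      ∀ z ∈ OmegaAff n, ‖f z - g z‖ ≤ ε := by
  refine forall₃_congr fun n ε _ => ⟨?_, ?_⟩
  · rintro ⟨P, Q, hQ, h⟩
    exact ⟨_, ⟨P, Q, hQ, fun _ _ => rfl⟩, h⟩
  · rintro ⟨g, ⟨P, Q, hQ, hPQ⟩, h⟩
    exact ⟨P, Q, hQ, fun z hz => hPQ z hz ▸ h z hz⟩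

theorem isRigidAnalytic_of_mem_rationalOn {f : Omega F → CInf F}
    (h : ∀ n, f ∈ rationalOn (OmegaAff n)) : IsRigidAnalytic f :=
  isRigidAnalytic_iff.2 fun n ε hε => ⟨f, h n, fun z _ => by simpa using hε.le⟩

namespace IsRigidAnalytic

variable {f g : Omega F → CInf F}

theorem exists_norm_le (hf : IsRigidAnalytic f) (n : ℕ) :
    ∃ B > 0, ∀ z ∈ OmegaAff n, ‖f z‖ ≤ B := by
  obtain ⟨g, hg, h⟩ := isRigidAnalytic_iff.1 hf n 1 one_pos
  obtain ⟨B, hB, hgB⟩ := exists_norm_le_of_mem_rationalOn hg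
  refine ⟨1 + B, by positivity, fun z hz => ?_⟩
  calc ‖f z‖ = ‖(f z - g z) + g z‖ := by rw [sub_add_cancel]
    _ ≤ 1 + B := (norm_add_le _ _).trans (add_le_add (h z hz) (hgB z hz))

theorem add (hf : IsRigidAnalytic f) (hg : IsRigidAnalytic g) : IsRigidAnalytic (f + g) := by
  refine isRigidAnalytic_iff.2 fun n ε hε => ?_
  obtain ⟨p, hp, hfp⟩ := isRigidAnalytic_iff.1 hf n ε hε
  obtain ⟨r, hr, hgr⟩ := isRigidAnalytic_iff.1 hg n ε hε
  refine ⟨p + r, add_mem hp hr, fun z hz => ?_⟩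
  rw [Pi.add_apply, Pi.add_apply, add_sub_add_comm]
  exact (IsUltrametricDist.norm_add_le_max _ _).trans (max_le (hfp z hz) (hgr z hz))

theorem mul (hf : IsRigidAnalytic f) (hg : IsRigidAnalytic g) : IsRigidAnalytic (f * g) := by
  refine isRigidAnalytic_iff.2 fun n ε hε => ?_
  obtain ⟨B, hB, hgB⟩ := hg.exists_norm_le n
  obtain ⟨p, hp, hfp⟩ := isRigidAnalytic_iff.1 hf n (ε / B) (div_pos hε hB)
  obtain ⟨D, hD, hpD⟩ := exists_norm_le_of_mem_rationalOn hp
  obtain ⟨r, hr, hgr⟩ := isRigidAnalytic_iff.1 hg n (ε / D) (div_pos hε hD)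
  refine ⟨p * r, mul_mem hp hr, fun z hz => ?_⟩
  calc ‖f z * g z - p z * r z‖ = ‖(f z - p z) * g z + p z * (g z - r z)‖ := by ring_nf
    _ ≤ max (‖f z - p z‖ * ‖g z‖) (‖p z‖ * ‖g z - r z‖) := by
      rw [← norm_mul, ← norm_mul]
      exact IsUltrametricDist.norm_add_le_max _ _
    _ ≤ max (ε / B * B) (D * (ε / D)) := by
      gcongr
      exacts [hfp z hz, hgB z hz, hpD z hz, hgr z hz]
    _ = ε := by rw [div_mul_cancel₀ _ hB.ne', mul_div_cancel₀ _ hD.ne', max_self]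

theorem comp_mob (hf : IsRigidAnalytic f) (γ : GL (Fin 2) (RatFunc F)) :
    IsRigidAnalytic (f ∘ mob γ) := by
  refine isRigidAnalytic_iff.2 fun n ε hε => ?_
  obtain ⟨n', hn'⟩ := exists_mapsTo_OmegaAff γ n
  obtain ⟨p, hp, hfp⟩ := isRigidAnalytic_iff.1 hf n' ε hε
  exact ⟨_, comp_mem_rationalOn hp (coe_mob_mem_rationalOn γ) hn', fun z hz => hfp _ (hn' hz)⟩

theorem slash (hf : IsRigidAnalytic f) (k m : ℤ) (γ : GL (Fin 2) (RatFunc F)) :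
    IsRigidAnalytic (slash k m f γ) :=
  (isRigidAnalytic_of_mem_rationalOn fun _ => mul_mem (const_mem_rationalOn _)
    (zpow_mem_rationalOn (denom_mem_rationalOn γ) (fun z _ => denom_ne_zero γ z) _)).mul
      (hf.comp_mob γ)

theorem of_tendstoUniformlyOn {ι : Type*} {l : Filter ι} [l.NeBot] {G : ι → Omega F → CInf F}
    (hG : ∀ i n, G i ∈ rationalOn (OmegaAff n))
    (h : ∀ n, TendstoUniformlyOn G f l (OmegaAff n)) : IsRigidAnalytic f := by
  refine isRigidAnalytic_iff.2 fun n ε hε => ?_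
  obtain ⟨i, hi⟩ := (Metric.tendstoUniformlyOn_iff.1 (h n) ε hε).exists
  exact ⟨G i, hG i n, fun z hz => (dist_eq_norm (f z) (G i z)).symm.trans_le (hi z hz).le⟩

end IsRigidAnalytic

variable (F) in
/-- The `ℂ_∞`-algebra of rigid analytic functions on `Ω`. -/
def rigidAnalytic : Subalgebra (CInf F) (Omega F → CInf F) where
  carrier := {f | IsRigidAnalytic f}
  mul_mem' := IsRigidAnalytic.mul
  add_mem' := IsRigidAnalytic.add
  algebraMap_mem' c := isRigidAnalytic_of_mem_rationalOn fun _ => const_mem_rationalOn c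

/-! ### Sums over polynomials of bounded degree -/

variable (F) in
/-- The polynomials of degree less than `N`, the summation range of the partial sums of `E`. -/
def degBall (N : ℕ) : Finset F[X] :=
  have : Finite (degreeLT F N) := .of_equiv _ (degreeLTEquiv F N).symm.toEquiv
  (Set.toFinite (degreeLT F N : Set F[X])).toFinset

theorem mem_degBall {N : ℕ} {p : F[X]} : p ∈ degBall F N ↔ p ∈ degreeLT F N := by
  simp [degBall]

theorem mem_degBall_iff_norm_lt {N : ℕ} {p : F[X]} :
    p ∈ degBall F N ↔ ‖(embA p : CInf F)‖ < (Fintype.card F : ℝ) ^ N := by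
  rw [mem_degBall, mem_degreeLT]
  rcases eq_or_ne p 0 with rfl | hp
  · simpa using pow_pos (card_pos F) N
  · rw [norm_embA hp, pow_lt_pow_iff_right₀ (one_lt_card F), natDegree_lt_iff_degree_lt hp]

theorem monotone_degBall : Monotone (degBall F) := fun _ _ hMN _ h =>
  mem_degBall.2 (degreeLT_mono hMN (mem_degBall.1 h))

theorem zero_mem_degBall (N : ℕ) : (0 : F[X]) ∈ degBall F N := mem_degBall.2 (zero_mem _)

theorem C_mul_mem_degBall {N : ℕ} {p : F[X]} (c : F) (h : p ∈ degBall F N) :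
    C c * p ∈ degBall F N :=
  mem_degBall.2 (by simpa only [smul_eq_C_mul] using
    (degreeLT F N).smul_mem c (mem_degBall.1 h))

theorem neg_mem_degBall {N : ℕ} {p : F[X]} (h : p ∈ degBall F N) : -p ∈ degBall F N :=
  mem_degBall.2 (neg_mem (mem_degBall.1 h))

theorem tendsto_embA_cofinite :
    Filter.Tendsto (embA : F[X] → CInf F) Filter.cofinite (Bornology.cobounded _) := by
  refine tendsto_norm_atTop_iff_cobounded.1 (Filter.tendsto_atTop.2 fun x => ?_)
  obtain ⟨N, hN⟩ := pow_unbounded_of_one_lt x (one_lt_card F)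
  refine (degBall F N).finite_toSet.subset fun a ha => mem_degBall_iff_norm_lt.2 ?_
  exact (not_le.1 (show ¬x ≤ ‖embA a‖ from ha)).trans hN

theorem sum_degBall_succ {M : Type*} [AddCommMonoid M] (N : ℕ) (g : F[X] → M) :
    ∑ b ∈ degBall F (N + 1), g b = ∑ b ∈ degBall F N, ∑ c : F, g (X * b + C c) := by
  rw [← Finset.sum_product']
  refine Finset.sum_bij' (fun p _ => (divX p, p.coeff 0)) (fun x _ => X * x.1 + C x.2)
    (fun p hp => ?_) (fun ⟨b, c⟩ hb => ?_) (fun p _ => X_mul_divX_add p)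
    (fun ⟨b, c⟩ _ => by ext <;> simp [divX_add, coeff_divX])
    (fun p _ => by rw [X_mul_divX_add])
  · simp only [Finset.mem_product, Finset.mem_univ, and_true, mem_degBall, mem_degreeLT,
      degree_lt_iff_coeff_zero, coeff_divX] at hp ⊢
    exact fun m hm => hp _ (by lia)
  · simp only [Finset.mem_product, Finset.mem_univ, and_true, mem_degBall, mem_degreeLT,
      degree_lt_iff_coeff_zero] at hb ⊢
    rintro (_ | m) hm
    · lia
    · rw [coeff_add, coeff_X_mul, coeff_C_succ, add_zero]
      exact hb m (by lia)

theorem card_nsmul_eq_zero (x : CInf F) : Fintype.card F • x = 0 := by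
  rw [nsmul_eq_mul, ← map_natCast (embA.comp C), Nat.cast_card_eq_zero, map_zero, zero_mul]

theorem natCard_units_nsmul (x : CInf F) : Nat.card Fˣ • x = -x := by
  refine eq_neg_of_add_eq_zero_left ?_
  rw [← succ_nsmul, ← Nat.card_eq_card_units_add_one, Nat.card_eq_fintype_card,
    card_nsmul_eq_zero]

theorem sum_degBall_const {N : ℕ} (hN : N ≠ 0) (x : CInf F) : ∑ _b ∈ degBall F N, x = 0 := by
  obtain ⟨N, rfl⟩ := Nat.exists_eq_succ_of_ne_zero hN
  rw [sum_degBall_succ]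
  exact Finset.sum_eq_zero fun b _ => by
    rw [Finset.sum_const, Finset.card_univ, card_nsmul_eq_zero]

variable (F) in
open Classical in
/-- The monic polynomials of degree less than `N`. -/
def monBall (N : ℕ) : Finset {a : F[X] // a.Monic} := (degBall F N).subtype _

theorem mem_monBall {N : ℕ} {a : {a : F[X] // a.Monic}} :
    a ∈ monBall F N ↔ a.1 ∈ degBall F N := by
  simp [monBall]

theorem sum_degBall_eq {M : Type*} [AddCommMonoid M] (N : ℕ) (g : F[X] → M)
    (hg : ∀ c : F, c ≠ 0 → ∀ a, g (C c * a) = g a) :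
    ∑ a ∈ degBall F N, g a = g 0 + Nat.card Fˣ • ∑ a ∈ monBall F N, g a.1 := by
  classical
  rw [← Finset.add_sum_erase _ _ (zero_mem_degBall N), Nat.card_eq_fintype_card,
    ← Finset.card_univ, ← Finset.sum_const, ← Finset.sum_product']
  congr 1
  symm
  refine Finset.sum_bij (fun x _ => C (x.1 : F) * x.2.1) (fun ⟨c, a⟩ hx => ?_)
    (fun ⟨c, a⟩ _ ⟨c', a'⟩ _ h => ?_) (fun p hp => ?_) (fun ⟨c, a⟩ _ => (hg _ c.ne_zero _).symm)
  · rw [Finset.mem_product, mem_monBall] at hx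
    exact Finset.mem_erase.2 ⟨mul_ne_zero (C_ne_zero.2 c.ne_zero) a.2.ne_zero,
      C_mul_mem_degBall _ hx.2⟩
  · have hc := congrArg leadingCoeff h
    simp only [leadingCoeff_mul, leadingCoeff_C, a.2.leadingCoeff, a'.2.leadingCoeff,
      mul_one] at hc
    obtain rfl : c = c' := Units.ext hc
    exact Prod.ext rfl (Subtype.ext (mul_left_cancel₀ (C_ne_zero.2 c.ne_zero) h))
  · obtain ⟨hp0, hp⟩ := Finset.mem_erase.1 hp
    have hl := leadingCoeff_ne_zero.2 hp0
    have hmonic : (C p.leadingCoeff⁻¹ * p).Monic :=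
      monic_C_mul_of_mul_leadingCoeff_eq_one (inv_mul_cancel₀ hl)
    refine ⟨(Units.mk0 _ hl, ⟨_, hmonic⟩), Finset.mem_product.2 ⟨Finset.mem_univ _,
      mem_monBall.2 (C_mul_mem_degBall _ hp)⟩, ?_⟩
    rw [Units.val_mk0, ← mul_assoc, ← C_mul, mul_inv_cancel₀ hl, C_1, one_mul]

/-! ### The lattice sums defining `E` -/

/-- The partial sum `∑_{deg b < N} a / (a z + b)`. -/
def latticeSum (N : ℕ) (a : F[X]) (z : Omega F) : CInf F :=
  ∑ b ∈ degBall F N, embA a / (embA a * z + embA b)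

/-- The inner sum `∑_{b ∈ A} a / (a z + b)` of the series defining `E`. -/
def latticeTsum (a : F[X]) (z : Omega F) : CInf F :=
  ∑' b : F[X], embA a / (embA a * z + embA b)

theorem norm_div_mul_add_le (z : Omega F) {a : F[X]} (ha : a ≠ 0) (b : F[X]) :
    ‖embA a / (embA a * (z : CInf F) + embA b)‖ ≤ (imAbs z)⁻¹ := by
  rw [norm_div, div_le_iff₀ (norm_pos_iff.2 (embA_mul_add_ne_zero z ha b)), ← div_eq_inv_mul,
    le_div_iff₀ (imAbs_pos z)]
  exact norm_embA_mul_imAbs_le z a b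

theorem norm_div_mul_add_le_of_notMem (z : Omega F) (a : F[X]) {b : F[X]} {N : ℕ}
    (hb : b ∉ degBall F N) (hN : ‖(embA a : CInf F)‖ * ‖(z : CInf F)‖ < (Fintype.card F : ℝ) ^ N) :
    ‖embA a / (embA a * (z : CInf F) + embA b)‖ ≤
      ‖(embA a : CInf F)‖ / (Fintype.card F : ℝ) ^ N := by
  have hbN : (Fintype.card F : ℝ) ^ N ≤ ‖(embA b : CInf F)‖ :=
    not_lt.1 (mem_degBall_iff_norm_lt.not.1 hb)
  have haz : ‖embA a * (z : CInf F)‖ < ‖(embA b : CInf F)‖ := by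
    rw [norm_mul]
    exact hN.trans_le hbN
  rw [norm_div, IsUltrametricDist.norm_add_eq_max_of_norm_ne_norm haz.ne, max_eq_right haz.le]
  have := pow_pos (card_pos F) N
  gcongr

theorem summable_div_mul_add (z : Omega F) (a : F[X]) :
    Summable fun b : F[X] => embA a / (embA a * (z : CInf F) + embA b) := by
  apply NonarchimedeanAddGroup.summable_of_tendsto_cofinite_zero
  simpa only [div_eq_mul_inv, mul_zero, Function.comp_def] using
    (Filter.tendsto_inv₀_cobounded.comp
      ((tendsto_const_add_cobounded (embA a * (z : CInf F))).comp
        tendsto_embA_cofinite)).const_mul (embA a)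

theorem tendsto_latticeSum (a : F[X]) (z : Omega F) :
    Filter.Tendsto (fun N => latticeSum N a z) Filter.atTop (nhds (latticeTsum a z)) :=
  (summable_div_mul_add z a).hasSum.comp <| monotone_degBall.tendsto_atTop_finset fun b =>
    ⟨b.natDegree + 1, mem_degBall.2 (mem_degreeLT.2 (degree_le_natDegree.trans_lt
      (by exact_mod_cast b.natDegree.lt_succ_self)))⟩

theorem norm_latticeTsum_sub_le (z : Omega F) (a : F[X]) {N : ℕ}
    (hN : ‖(embA a : CInf F)‖ * ‖(z : CInf F)‖ < (Fintype.card F : ℝ) ^ N) :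
    ‖latticeTsum a z - latticeSum N a z‖ ≤ ‖(embA a : CInf F)‖ / (Fintype.card F : ℝ) ^ N := by
  rw [latticeTsum, latticeSum,
    ← (summable_div_mul_add z a).sum_add_tsum_subtype_compl (degBall F N), add_sub_cancel_left]
  exact IsUltrametricDist.norm_tsum_le_of_forall_le_of_nonneg
    (div_nonneg (norm_nonneg _) (pow_pos (card_pos F) N).le)
    fun b => norm_div_mul_add_le_of_notMem z a b.2 hN

/-- Since `∑_c 1 / w = 0` in characteristic `p`, the sum has size `|w|⁻²` rather than `|w|⁻¹`. -/
theorem norm_sum_inv_add_le {w : CInf F} {δ : ℝ} (hδ : 0 < δ)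
    (hw : ∀ c : F, δ ≤ ‖w + embA (C c)‖) :
    ‖∑ c : F, (w + embA (C c))⁻¹‖ ≤ δ⁻¹ * δ⁻¹ := by
  have hw0 : δ ≤ ‖w‖ := by simpa using hw 0
  have hne0 : w ≠ 0 := norm_pos_iff.1 (hδ.trans_le hw0)
  have hne (c : F) : w + embA (C c) ≠ 0 := norm_pos_iff.1 (hδ.trans_le (hw c))
  have hsum : ∑ c : F, (w + embA (C c))⁻¹ =
      ∑ c : F, -(embA (C c) * (w⁻¹ * (w + embA (C c))⁻¹)) := by
    rw [← sub_zero (∑ c : F, (w + embA (C c))⁻¹), ← card_nsmul_eq_zero (w⁻¹), ← Finset.card_univ,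
      ← Finset.sum_const, ← Finset.sum_sub_distrib]
    refine Finset.sum_congr rfl fun c _ => ?_
    have := hne c
    field_simp
    ring
  have hC (c : F) : ‖(embA (C c) : CInf F)‖ ≤ 1 := by
    rcases eq_or_ne c 0 with rfl | hc
    · simp
    · rw [norm_embA (C_ne_zero.2 hc), natDegree_C, pow_zero]
  rw [hsum]
  refine IsUltrametricDist.norm_sum_le_of_forall_le_of_nonneg (by positivity) fun c _ => ?_
  rw [norm_neg, norm_mul, norm_mul, norm_inv, norm_inv]
  calc ‖(embA (C c) : CInf F)‖ * (‖w‖⁻¹ * ‖w + embA (C c)‖⁻¹) ≤ 1 * (δ⁻¹ * δ⁻¹) := by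
        gcongr
        exacts [hC c, hw c]
    _ = δ⁻¹ * δ⁻¹ := one_mul _

theorem norm_latticeSum_le (z : Omega F) {a : F[X]} (ha : a ≠ 0) {N : ℕ} (hN : N ≠ 0) :
    ‖latticeSum N a z‖ ≤ (imAbs z)⁻¹ ^ 2 / ‖(embA a : CInf F)‖ := by
  obtain ⟨N, rfl⟩ := Nat.exists_eq_succ_of_ne_zero hN
  have hz := imAbs_pos z
  have ha' := norm_pos_iff.2 (embA_ne_zero ha)
  rw [latticeSum, sum_degBall_succ]
  refine IsUltrametricDist.norm_sum_le_of_forall_le_of_nonneg (by positivity) fun b _ => ?_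
  have hsum : ∑ c : F, embA a / (embA a * (z : CInf F) + embA (X * b + C c)) =
      embA a * ∑ c : F, (embA a * (z : CInf F) + embA (X * b) + embA (C c))⁻¹ := by
    simp only [Finset.mul_sum, map_add, add_assoc, div_eq_mul_inv]
  set δ : ℝ := ‖(embA a : CInf F)‖ * imAbs z with hδ
  calc _ ≤ ‖(embA a : CInf F)‖ * (δ⁻¹ * δ⁻¹) := by
        rw [hsum, norm_mul]
        gcongr
        refine norm_sum_inv_add_le (mul_pos ha' hz) fun c => ?_
        rw [add_assoc, ← map_add]
        exact norm_embA_mul_imAbs_le z a _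
    _ = _ := by rw [hδ]; field_simp

theorem norm_latticeTsum_le (z : Omega F) {a : F[X]} (ha : a ≠ 0) :
    ‖latticeTsum a z‖ ≤ (imAbs z)⁻¹ ^ 2 / ‖(embA a : CInf F)‖ :=
  le_of_tendsto (tendsto_latticeSum a z).norm <|
    (Filter.eventually_ne_atTop 0).mono fun _ hN => norm_latticeSum_le z ha hN

theorem summable_latticeTsum (z : Omega F) :
    Summable fun a : {a : F[X] // a.Monic} => latticeTsum a.1 z := by
  apply NonarchimedeanAddGroup.summable_of_tendsto_cofinite_zero
  refine squeeze_zero_norm (fun a => norm_latticeTsum_le z a.2.ne_zero) ?_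
  exact tendsto_const_nhds.div_atTop ((tendsto_norm_atTop_iff_cobounded.2
    tendsto_embA_cofinite).comp Subtype.val_injective.tendsto_cofinite)

theorem norm_falseE_le (π : CInf F) (z : Omega F) : ‖falseE π z‖ ≤ ‖π‖⁻¹ * (imAbs z)⁻¹ := by
  have hz : 0 ≤ (imAbs z)⁻¹ := inv_nonneg.2 (imAbs_pos z).le
  rw [falseE, norm_mul, norm_inv]
  gcongr
  exact IsUltrametricDist.norm_tsum_le_of_forall_le_of_nonneg hz fun a =>
    IsUltrametricDist.norm_tsum_le_of_forall_le_of_nonneg hz fun b =>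
      norm_div_mul_add_le z a.2.ne_zero b

/-- The partial sum of `E` over polynomials `a` and `b` of degree less than `N`. -/
def partialE (π : CInf F) (N : ℕ) (z : Omega F) : CInf F :=
  π⁻¹ * ∑ a ∈ monBall F N, latticeSum N a.1 z

theorem inv_imAbs_sq_div_le {n M : ℕ} {z : Omega F} (hz : z ∈ OmegaAff n) {a : F[X]}
    (ha : a ∉ degBall F M) :
    (imAbs z)⁻¹ ^ 2 / ‖(embA a : CInf F)‖ ≤
      ((Fintype.card F : ℝ) ^ n) ^ 2 / (Fintype.card F : ℝ) ^ M := by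
  have := pow_pos (card_pos F) M
  have hpos := (imAbs_pos z).le
  gcongr
  · exact inv_le_of_inv_le₀ (pow_pos (card_pos F) n) hz.2
  · exact not_lt.1 (mem_degBall_iff_norm_lt.not.1 ha)

theorem norm_latticeTsum_sub_latticeSum_le {n M N : ℕ} (hM : 2 * M ≤ N) (hn : M + n ≤ N)
    (hN : N ≠ 0) {z : Omega F} (hz : z ∈ OmegaAff n) {a : F[X]} (ha : a ≠ 0) :
    ‖latticeTsum a z - latticeSum N a z‖ ≤
      ((Fintype.card F : ℝ) ^ n) ^ 2 / (Fintype.card F : ℝ) ^ M := by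
  have hq := one_lt_card F
  have hpos (i : ℕ) := pow_pos (card_pos F) i
  by_cases haM : a ∈ degBall F M
  · replace haM := mem_degBall_iff_norm_lt.1 haM
    have hazN : ‖(embA a : CInf F)‖ * ‖(z : CInf F)‖ < (Fintype.card F : ℝ) ^ N :=
      calc _ < (Fintype.card F : ℝ) ^ M * (Fintype.card F : ℝ) ^ n :=
            mul_lt_mul_of_lt_of_le_of_nonneg_of_pos haM hz.1 (norm_nonneg _) (hpos n)
        _ ≤ _ := by rw [← pow_add]; exact pow_le_pow_right₀ hq.le hn
    refine (norm_latticeTsum_sub_le z a hazN).trans ?_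
    rw [div_le_div_iff₀ (hpos N) (hpos M)]
    calc ‖(embA a : CInf F)‖ * (Fintype.card F : ℝ) ^ M
        ≤ (Fintype.card F : ℝ) ^ M * (Fintype.card F : ℝ) ^ M := by gcongr
      _ = 1 * (Fintype.card F : ℝ) ^ (2 * M) := by ring
      _ ≤ ((Fintype.card F : ℝ) ^ n) ^ 2 * (Fintype.card F : ℝ) ^ N := by
        gcongr
        · exact one_le_pow₀ (one_le_pow₀ hq.le)
        · exact hq.le
  · have hle := inv_imAbs_sq_div_le hz haM
    exact (norm_sub_le_max _ _).trans (max_le ((norm_latticeTsum_le z ha).trans hle)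
      ((norm_latticeSum_le z ha hN).trans hle))

theorem norm_falseE_sub_partialE_le (π : CInf F) {n M N : ℕ} (hM : 2 * M ≤ N) (hn : M + n ≤ N)
    (hN : N ≠ 0) {z : Omega F} (hz : z ∈ OmegaAff n) :
    ‖falseE π z - partialE π N z‖ ≤
      ‖π⁻¹‖ * (((Fintype.card F : ℝ) ^ n) ^ 2 / (Fintype.card F : ℝ) ^ M) := by
  have hnonneg : 0 ≤ ((Fintype.card F : ℝ) ^ n) ^ 2 / (Fintype.card F : ℝ) ^ M := by positivity
  have hsplit : falseE π z - partialE π N z = π⁻¹ *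
      (∑ a ∈ monBall F N, (latticeTsum a.1 z - latticeSum N a.1 z) +
        ∑' a : ↥((monBall F N : Set {a : F[X] // a.Monic})ᶜ), latticeTsum a.1.1 z) := by
    rw [falseE, partialE, ← mul_sub, Finset.sum_sub_distrib, sub_add_eq_add_sub]
    exact congrArg (fun x => π⁻¹ * (x - _))
      ((summable_latticeTsum z).sum_add_tsum_subtype_compl (monBall F N)).symm
  rw [hsplit, norm_mul]
  gcongr
  refine (IsUltrametricDist.norm_add_le_max _ _).trans (max_le ?_ ?_)
  · exact IsUltrametricDist.norm_sum_le_of_forall_le_of_nonneg hnonneg fun a _ =>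
      norm_latticeTsum_sub_latticeSum_le hM hn hN hz a.2.ne_zero
  · refine IsUltrametricDist.norm_tsum_le_of_forall_le_of_nonneg hnonneg fun a => ?_
    have haM : a.1.1 ∉ degBall F M := fun h =>
      a.2 (mem_monBall.2 (monotone_degBall (by lia) h))
    exact (norm_latticeTsum_le z a.1.2.ne_zero).trans (inv_imAbs_sq_div_le hz haM)

theorem tendstoUniformlyOn_partialE (π : CInf F) (n : ℕ) :
    TendstoUniformlyOn (partialE π) (falseE π) Filter.atTop (OmegaAff n) := by
  refine Metric.tendstoUniformlyOn_iff.2 fun ε hε => ?_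
  have hlim : Filter.Tendsto (fun M : ℕ => ‖π⁻¹‖ *
      (((Fintype.card F : ℝ) ^ n) ^ 2 / (Fintype.card F : ℝ) ^ M)) Filter.atTop (nhds 0) := by
    simpa only [mul_zero] using (tendsto_const_nhds.div_atTop
      (tendsto_pow_atTop_atTop_of_one_lt (one_lt_card F))).const_mul ‖π⁻¹‖
  obtain ⟨M, hM⟩ := (hlim.eventually_lt_const hε).exists
  filter_upwards [Filter.eventually_ge_atTop (2 * M + n + 1)] with N hN z hz
  rw [dist_eq_norm]
  exact (norm_falseE_sub_partialE_le π (by lia) (by lia) (by lia) hz).trans_lt hM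

theorem isRigidAnalytic_falseE (π : CInf F) : IsRigidAnalytic (falseE π) := by
  refine .of_tendstoUniformlyOn (fun N n => ?_) (tendstoUniformlyOn_partialE π)
  have hsum : partialE π N = (fun _ => π⁻¹) * ∑ a ∈ monBall F N, ∑ b ∈ degBall F N,
      (fun _ => embA a.1) * (fun z : Omega F => embA a.1 * (z : CInf F) + embA b)⁻¹ := by
    ext z
    simp only [partialE, latticeSum, div_eq_mul_inv, Pi.mul_apply, Finset.sum_apply, Pi.inv_apply]
  rw [hsum]
  exact mul_mem (const_mem_rationalOn _) <| sum_mem fun a _ => sum_mem fun b _ =>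
    mul_mem (const_mem_rationalOn _) <| inv_mem_rationalOn (mul_add_mem_rationalOn _ _)
      fun z _ => embA_mul_add_ne_zero z a.2.ne_zero b

theorem tendsto_partialE (π : CInf F) (z : Omega F) :
    Filter.Tendsto (fun N => partialE π N z) Filter.atTop (nhds (falseE π z)) :=
  (exists_mem_OmegaAff z).elim fun n hz => (tendstoUniformlyOn_partialE π n).tendsto_at hz

/-! ### Functional equations of `E` -/

theorem latticeSum_C_mul (N : ℕ) {c : F} (hc : c ≠ 0) (a : F[X]) (z : Omega F) :
    latticeSum N (C c * a) z = latticeSum N a z := by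
  have hC : (C c * C c⁻¹ : F[X]) = 1 := by rw [← C_mul, mul_inv_cancel₀ hc, C_1]
  refine Finset.sum_bij' (fun b _ => C c⁻¹ * b) (fun b _ => C c * b)
    (fun b hb => C_mul_mem_degBall _ hb) (fun b hb => C_mul_mem_degBall _ hb)
    (fun b _ => by rw [← mul_assoc, hC, one_mul])
    (fun b _ => by rw [← mul_assoc, mul_comm (C _), hC, one_mul]) fun b _ => ?_
  have hb : (embA b : CInf F) = embA (C c) * embA (C c⁻¹ * b) := by
    rw [← map_mul, ← mul_assoc, hC, one_mul]
  rw [hb, map_mul, mul_assoc, ← mul_add, mul_div_mul_left _ _ (embA_ne_zero (C_ne_zero.2 hc))]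

theorem partialE_eq (π : CInf F) (N : ℕ) (z : Omega F) :
    partialE π N z = -(π⁻¹ * ∑ a ∈ degBall F N, latticeSum N a z) := by
  rw [sum_degBall_eq N (latticeSum N · z) fun c hc a => latticeSum_C_mul N hc a z,
    natCard_units_nsmul, partialE]
  simp [latticeSum]

theorem sq_mul_sum_latticeSum_add (z : Omega F) {N : ℕ} (hN : N ≠ 0) :
    (z : CInf F) ^ 2 * ∑ a ∈ degBall F N, latticeSum N a z +
      z * ∑ a ∈ degBall F N, ∑ b ∈ degBall F N, embA b / (embA a * (z : CInf F) + embA b) =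
        -z := by
  classical
  have hterm (a b : F[X]) : (z : CInf F) ^ 2 * (embA a / (embA a * (z : CInf F) + embA b)) +
      z * (embA b / (embA a * (z : CInf F) + embA b)) = z - if a = 0 ∧ b = 0 then ↑z else 0 := by
    split_ifs with h
    · simp [h.1, h.2]
    · have hne : embA a * (z : CInf F) + embA b ≠ 0 := by
        by_cases ha : a = 0
        · simpa [ha] using embA_ne_zero fun hb => h ⟨ha, hb⟩
        · exact embA_mul_add_ne_zero z ha b
      rw [sub_zero, mul_div_assoc', mul_div_assoc', ← add_div, div_eq_iff hne]
      ring
  simp only [latticeSum, Finset.mul_sum, ← Finset.sum_add_distrib, hterm, ite_and]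
  simp [Finset.sum_sub_distrib, sum_degBall_const hN, zero_mem_degBall]

theorem sum_latticeSum_neg_inv {z w : Omega F} (hw : (w : CInf F) = -(z : CInf F)⁻¹) (N : ℕ) :
    ∑ a ∈ degBall F N, latticeSum N a w =
      -(z * ∑ a ∈ degBall F N, ∑ b ∈ degBall F N,
        embA b / (embA a * (z : CInf F) + embA b)) := by
  have hz := z.ne_zero
  rw [Finset.sum_comm, Finset.mul_sum, ← Finset.sum_neg_distrib]
  refine Finset.sum_congr rfl fun a _ => ?_
  rw [Finset.mul_sum, ← Finset.sum_neg_distrib]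
  refine Finset.sum_nbij' (-·) (-·) (fun _ => neg_mem_degBall) (fun _ => neg_mem_degBall)
    (fun _ _ => neg_neg _) (fun _ _ => neg_neg _) fun b _ => ?_
  have hdenom : embA a * (w : CInf F) + embA b =
      -((z : CInf F)⁻¹ * (embA (-b) * z + embA a)) := by
    rw [hw, map_neg]
    field_simp
    ring
  rw [hdenom, div_neg, div_mul_eq_div_div, div_inv_eq_mul, mul_comm (embA a), mul_div_assoc]

theorem falseE_neg_inv (π : CInf F) {z w : Omega F} (hw : (w : CInf F) = -(z : CInf F)⁻¹) :
    falseE π w = (z : CInf F) ^ 2 * falseE π z - π⁻¹ * z := by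
  refine tendsto_nhds_unique_of_eventuallyEq (tendsto_partialE π w)
    (((tendsto_partialE π z).const_mul _).sub_const _) ?_
  filter_upwards [Filter.eventually_ne_atTop 0] with N hN
  rw [partialE_eq, partialE_eq, sum_latticeSum_neg_inv hw]
  linear_combination π⁻¹ * sq_mul_sum_latticeSum_add z hN

theorem latticeTsum_C_mul_add {e : F} (he : e ≠ 0) (a c : F[X]) {z w : Omega F}
    (hw : (w : CInf F) = embA (C e) * z + embA c) :
    latticeTsum a w = (embA (C e))⁻¹ * latticeTsum a z := by
  have hu : IsUnit (C e : F[X]) := isUnit_C.2 he.isUnit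
  rw [latticeTsum, latticeTsum, ← tsum_mul_left,
    ← ((Units.mulLeft hu.unit).trans (Equiv.subRight (a * c))).tsum_eq]
  refine tsum_congr fun b => ?_
  simp only [Equiv.trans_apply, Units.mulLeft_apply, IsUnit.unit_spec, Equiv.subRight_apply,
    map_sub, map_mul, hw]
  rw [show embA a * (embA (C e) * (z : CInf F) + embA c) +
      (embA (C e) * embA b - embA a * embA c) = embA (C e) * (embA a * z + embA b) by ring,
    div_mul_eq_div_div_swap, div_eq_inv_mul (_ / _)]

theorem falseE_C_mul_add (π : CInf F) {e : F} (he : e ≠ 0) (c : F[X]) {z w : Omega F}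
    (hw : (w : CInf F) = embA (C e) * z + embA c) :
    falseE π w = (embA (C e))⁻¹ * falseE π z :=
  calc falseE π w = π⁻¹ * ∑' a : {a : F[X] // a.Monic}, latticeTsum a.1 w := rfl
    _ = π⁻¹ * ((embA (C e))⁻¹ * ∑' a : {a : F[X] // a.Monic}, latticeTsum a.1 z) := by
      simp only [latticeTsum_C_mul_add he _ c hw, tsum_mul_left]
    _ = (embA (C e))⁻¹ * falseE π z := mul_left_comm _ _ _

end

/-! ### Integral matrices and the groups `Γ₀(𝔪)` -/

/-- An integral matrix of nonzero determinant, as an element of `GL₂(K)`. -/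
def toGL (M : Matrix (Fin 2) (Fin 2) F[X]) (h : M.det ≠ 0) : GL (Fin 2) (RatFunc F) :=
  Matrix.GeneralLinearGroup.mkOfDetNeZero (M.map (algebraMap F[X] (RatFunc F))) (by
    rw [← RingHom.mapMatrix_apply, ← RingHom.map_det]
    exact RatFunc.algebraMap_ne_zero h)

theorem toGL_apply (M : Matrix (Fin 2) (Fin 2) F[X]) (h : M.det ≠ 0) (i j : Fin 2) :
    toGL M h i j = algebraMap F[X] (RatFunc F) (M i j) := rfl

theorem toGL_mul (M N : Matrix (Fin 2) (Fin 2) F[X]) (hM : M.det ≠ 0) (hN : N.det ≠ 0)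
    (h : (M * N).det ≠ 0) : toGL (M * N) h = toGL M hM * toGL N hN :=
  Units.ext Matrix.map_mul

theorem toGL_mul_toGL_inj {M N M' N' : Matrix (Fin 2) (Fin 2) F[X]} {hM : M.det ≠ 0}
    {hN : N.det ≠ 0} {hM' : M'.det ≠ 0} {hN' : N'.det ≠ 0} :
    toGL M hM * toGL N hN = toGL M' hM' * toGL N' hN' ↔ M * N = M' * N' := by
  rw [Units.ext_iff]
  change M.map _ * N.map _ = M'.map _ * N'.map _ ↔ _
  rw [← Matrix.map_mul, ← Matrix.map_mul,
    (Matrix.map_injective (RatFunc.algebraMap_injective F)).eq_iff]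

theorem toGL_mem_Gamma0 {𝔪 : Ideal F[X]} {M : Matrix (Fin 2) (Fin 2) F[X]} (h : IsUnit M.det)
    (hM : M 1 0 ∈ 𝔪) : toGL M h.ne_zero ∈ Gamma0 𝔪 :=
  ⟨Matrix.GeneralLinearGroup.mk'' M h, hM, Units.ext rfl⟩

theorem mem_Gamma0_iff {𝔪 : Ideal F[X]} {γ : GL (Fin 2) (RatFunc F)} :
    γ ∈ Gamma0 𝔪 ↔ ∃ a b c d, ∃ h : IsUnit !![a, b; c, d].det, c ∈ 𝔪 ∧
      toGL _ h.ne_zero = γ := by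
  constructor
  · rintro ⟨g, hg, rfl⟩
    have hdet := (Matrix.isUnit_iff_isUnit_det _).1 g.isUnit
    have heta := Matrix.eta_fin_two (g : Matrix (Fin 2) (Fin 2) F[X])
    refine ⟨g 0 0, g 0 1, g 1 0, g 1 1, heta ▸ hdet, hg, Units.ext ?_⟩
    exact congrArg (Matrix.map · (algebraMap F[X] (RatFunc F))) heta.symm
  · rintro ⟨a, b, c, d, h, hc, rfl⟩
    exact toGL_mem_Gamma0 h hc

theorem Gamma0_mono {𝔪 𝔫 : Ideal F[X]} (h : 𝔪 ≤ 𝔫) : Gamma0 𝔪 ≤ Gamma0 𝔫 :=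
  Subgroup.map_mono fun _ hγ => h hγ

/-- The translation `z ↦ z + b`. -/
def transMat (b : F[X]) : GL (Fin 2) (RatFunc F) := toGL !![1, b; 0, 1] (by simp)

variable (F) in
/-- The inversion `z ↦ -1 / z`. -/
def invMat : GL (Fin 2) (RatFunc F) := toGL !![0, 1; -1, 0] (by simp)

theorem transMat_mem_Gamma0 (𝔪 : Ideal F[X]) (b : F[X]) : transMat b ∈ Gamma0 𝔪 :=
  toGL_mem_Gamma0 (by simp) (by simp)

/-- The Euclidean algorithm: left multiplication by a translation replaces the first column
`(a, c)` by `(a % c, c)`, and the inversion swaps its entries. The upper triangular matrices in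
`GL₂(A)` are those of `Γ₀(0)`. -/
theorem Gamma0_le_of_bot_le {H : Subgroup (GL (Fin 2) (RatFunc F))} (hbot : Gamma0 ⊥ ≤ H)
    (hinv : invMat F ∈ H) (𝔪 : Ideal F[X]) : Gamma0 𝔪 ≤ H := by
  suffices key : ∀ c a b d : F[X], ∀ h : IsUnit !![a, b; c, d].det, toGL _ h.ne_zero ∈ H by
    intro γ hγ
    obtain ⟨a, b, c, d, h, -, rfl⟩ := mem_Gamma0_iff.1 hγ
    exact key c a b d h
  intro c
  induction c using (EuclideanDomain.r_wellFounded (R := F[X])).induction with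
  | _ c ih =>
  intro a b d h
  rcases eq_or_ne c 0 with rfl | hc
  · exact hbot (toGL_mem_Gamma0 h rfl)
  have hdet : IsUnit !![-c, -d; a % c, b - a / c * d].det := by
    convert h using 1
    rw [Matrix.det_fin_two_of, Matrix.det_fin_two_of]
    linear_combination d * EuclideanDomain.mod_add_div a c
  have hstep : transMat (-(a / c)) * toGL _ h.ne_zero = invMat F * toGL _ hdet.ne_zero := by
    refine toGL_mul_toGL_inj.2 ?_
    have hmod : a % c = a - a / c * c := by
      linear_combination EuclideanDomain.mod_add_div a c
    ext i j : 1
    fin_cases i <;> fin_cases j <;> simp [hmod, sub_eq_add_neg]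
  exact (H.mul_mem_cancel_left (hbot (transMat_mem_Gamma0 _ _))).1 <| hstep ▸
    H.mul_mem hinv (ih _ (EuclideanDomain.mod_lt a hc) _ _ _ hdet)

/-! ### Representatives of `Γ \ Γ η Γ` -/

namespace IsCosetReps

variable {Γ : Subgroup (GL (Fin 2) (RatFunc F))} {η : GL (Fin 2) (RatFunc F)}
  {R R' : Finset (GL (Fin 2) (RatFunc F))}

theorem sum_eq (hR : IsCosetReps Γ η R) (hR' : IsCosetReps Γ η R') {M : Type*} [AddCommMonoid M]
    {φ : GL (Fin 2) (RatFunc F) → M} (hφ : ∀ α ∈ Γ, ∀ γ, φ (α * γ) = φ γ) :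
    ∑ r ∈ R, φ r = ∑ r ∈ R', φ r := by
  choose! f hf using fun r hr => (hR'.2 r (hR.1 r hr)).exists
  choose! g hg using fun r hr => (hR.2 r (hR'.1 r hr)).exists
  refine Finset.sum_bij' (fun r _ => f r) (fun r _ => g r) (fun r hr => (hf r hr).1)
    (fun r hr => (hg r hr).1) (fun r hr => ?_) (fun r hr => ?_) (fun r hr => ?_)
  · have hfr := hf r hr
    have hgr := hg _ hfr.1
    refine (hR.2 r (hR.1 r hr)).unique ⟨hgr.1, ?_⟩ ⟨hr, by simp⟩
    simpa [mul_assoc] using Γ.mul_mem hfr.2 hgr.2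
  · have hgr := hg r hr
    have hfr := hf _ hgr.1
    refine (hR'.2 r (hR'.1 r hr)).unique ⟨hfr.1, ?_⟩ ⟨hr, by simp⟩
    simpa [mul_assoc] using Γ.mul_mem hgr.2 hfr.2
  · simpa using hφ _ (hf r hr).2 (f r)

theorem map_mulRight (hR : IsCosetReps Γ η R) {δ : GL (Fin 2) (RatFunc F)} (hδ : δ ∈ Γ) :
    IsCosetReps Γ η (R.map (mulRightEmbedding δ)) := by
  have hmul : ∀ x ∈ DoubleCoset.doubleCoset η (Γ : Set (GL (Fin 2) (RatFunc F))) Γ, ∀ ε ∈ Γ,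
      x * ε ∈ DoubleCoset.doubleCoset η (Γ : Set (GL (Fin 2) (RatFunc F))) Γ := by
    intro x hx ε hε
    obtain ⟨a, ha, b, hb, rfl⟩ := DoubleCoset.mem_doubleCoset.1 hx
    exact DoubleCoset.mem_doubleCoset.2 ⟨a, ha, b * ε, Γ.mul_mem hb hε, mul_assoc _ _ _⟩
  constructor
  · simpa using fun r hr => hmul r (hR.1 r hr) δ hδ
  · intro x hx
    obtain ⟨r, ⟨hr, hxr⟩, huniq⟩ := hR.2 _ (hmul x hx δ⁻¹ (Γ.inv_mem hδ))
    refine ⟨r * δ, ⟨Finset.mem_map_of_mem _ hr, by simpa [mul_assoc] using hxr⟩, ?_⟩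
    rintro _ ⟨hs, hxs⟩
    obtain ⟨s, hsR, rfl⟩ := Finset.mem_map.1 hs
    exact congrArg (· * δ) (huniq s ⟨hsR, by simpa [mul_assoc] using hxs⟩)

end IsCosetReps

section

variable {ϖ : F[X]} {𝔪 : Ideal F[X]}

theorem diagGL_eq_toGL (a d : F[X]) (ha : a ≠ 0) (hd : d ≠ 0) :
    diagGL a d ha hd = toGL !![a, 0; 0, d] (by simp [ha, hd]) := by
  apply Units.ext
  ext i j
  fin_cases i <;> fin_cases j <;> simp [diagGL, toGL_apply]

theorem exists_diagGL_mul_eq (h0 : ϖ ≠ 0) {γ : GL (Fin 2) (RatFunc F)}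
    (hγ : γ ∈ Gamma0 (𝔪 * Ideal.span {ϖ})) :
    ∃ γ' ∈ Gamma0 𝔪, diagGL ϖ 1 h0 one_ne_zero * γ = γ' * diagGL ϖ 1 h0 one_ne_zero := by
  obtain ⟨a, b, c, d, hu, hc, rfl⟩ := mem_Gamma0_iff.1 hγ
  obtain ⟨μ, hμ, rfl⟩ := Ideal.mem_mul_span_singleton.1 hc
  have hdet : !![a, ϖ * b; μ, d].det = !![a, b; μ * ϖ, d].det := by
    rw [Matrix.det_fin_two_of, Matrix.det_fin_two_of]
    ring
  refine ⟨_, toGL_mem_Gamma0 (hdet ▸ hu) hμ, ?_⟩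
  rw [diagGL_eq_toGL, toGL_mul_toGL_inj]
  simp [mul_comm]

theorem heckeMat_mul_mem_or (hirr : Irreducible ϖ) {y : GL (Fin 2) (RatFunc F)}
    (hy : y ∈ Gamma0 𝔪) :
    (∃ α ∈ Gamma0 𝔪, heckeMat ϖ hirr.ne_zero * y =
      α * diagGL ϖ 1 hirr.ne_zero one_ne_zero) ∨
    ∃ α ∈ Gamma0 𝔪, ∃ s, heckeMat ϖ hirr.ne_zero * y =
      α * (heckeMat ϖ hirr.ne_zero * transMat s) := by
  obtain ⟨a, b, c, d, hu, hc, rfl⟩ := mem_Gamma0_iff.1 hy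
  by_cases hdvd : ϖ ∣ a
  · left
    obtain ⟨a, rfl⟩ := hdvd
    have hdet : !![a, b; c, ϖ * d].det = !![ϖ * a, b; c, d].det := by
      rw [Matrix.det_fin_two_of, Matrix.det_fin_two_of]
      ring
    refine ⟨_, toGL_mem_Gamma0 (hdet ▸ hu) hc, ?_⟩
    rw [heckeMat, diagGL_eq_toGL, diagGL_eq_toGL, toGL_mul_toGL_inj]
    simp [mul_comm]
  · right
    obtain ⟨u, v, huv⟩ := hirr.coprime_iff_not_dvd.2 hdvd
    have hdet : !![a, u * b; ϖ * c, d - c * (v * b)].det = !![a, b; c, d].det := by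
      rw [Matrix.det_fin_two_of, Matrix.det_fin_two_of]
      linear_combination (-(b * c)) * huv
    refine ⟨_, toGL_mem_Gamma0 (hdet ▸ hu) (𝔪.mul_mem_left _ hc), v * b, ?_⟩
    have hprod : !![1, 0; 0, ϖ] * !![1, v * b; 0, 1] = !![1, v * b; 0, ϖ] := by simp
    rw [transMat, heckeMat, diagGL_eq_toGL,
      ← toGL_mul !![1, 0; 0, ϖ] !![1, v * b; 0, 1] _ _ (by simp [hirr.ne_zero]),
      toGL_mul_toGL_inj, hprod]
    ext i j : 1
    fin_cases i <;> fin_cases j <;> simp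
    · linear_combination (-b) * huv
    · ring

theorem diagGL_mem_doubleCoset (hirr : Irreducible ϖ) (hndvd : ¬ Ideal.span {ϖ} ∣ 𝔪) :
    diagGL ϖ 1 hirr.ne_zero one_ne_zero ∈ DoubleCoset.doubleCoset (heckeMat ϖ hirr.ne_zero)
      (Gamma0 𝔪 : Set (GL (Fin 2) (RatFunc F))) (Gamma0 𝔪) := by
  rw [Ideal.dvd_iff_le, SetLike.not_le_iff_exists] at hndvd
  obtain ⟨μ, hμ, hμ'⟩ := hndvd
  rw [Ideal.mem_span_singleton] at hμ'
  obtain ⟨u, v, huv⟩ := hirr.coprime_iff_not_dvd.2 hμ'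
  have hx : !![1, -v; μ, ϖ * u].det = 1 := by
    rw [Matrix.det_fin_two_of]
    linear_combination huv
  have hy : !![ϖ, -v; μ, u].det = 1 := by
    rw [Matrix.det_fin_two_of]
    linear_combination huv
  refine DoubleCoset.mem_doubleCoset.2 ⟨_,
    (Gamma0 𝔪).inv_mem (toGL_mem_Gamma0 (hx ▸ isUnit_one) hμ), _,
    toGL_mem_Gamma0 (hy ▸ isUnit_one) hμ, ?_⟩
  rw [mul_assoc, eq_inv_mul_iff_mul_eq, heckeMat, diagGL_eq_toGL, diagGL_eq_toGL,
    toGL_mul_toGL_inj]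
  simp [mul_comm]

theorem heckeMat_conj_mem (h0 : ϖ ≠ 0) {y : GL (Fin 2) (RatFunc F)} (hy : y ∈ Gamma0 𝔪)
    (h : heckeMat ϖ h0 * y * (heckeMat ϖ h0)⁻¹ ∈ Gamma0 (⊤ : Ideal F[X])) :
    heckeMat ϖ h0 * y * (heckeMat ϖ h0)⁻¹ ∈ Gamma0 (𝔪 * Ideal.span {ϖ}) := by
  obtain ⟨a, b, c, d, hu, hc, rfl⟩ := mem_Gamma0_iff.1 hy
  obtain ⟨a', b', c', d', hu', -, hconj⟩ := mem_Gamma0_iff.1 h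
  refine hconj ▸ toGL_mem_Gamma0 hu' ?_
  rw [eq_mul_inv_iff_mul_eq, heckeMat, diagGL_eq_toGL, toGL_mul_toGL_inj] at hconj
  have hc' : c' = ϖ * c := by simpa using congrFun₂ hconj 1 0
  change c' ∈ _
  rw [hc', mul_comm ϖ]
  exact Ideal.mul_mem_mul hc (Ideal.mem_span_singleton_self ϖ)

theorem diagGL_mul_mul_inv_notMem (hirr : Irreducible ϖ) {y : GL (Fin 2) (RatFunc F)}
    (hy : y ∈ Gamma0 (Ideal.span {ϖ})) :
    diagGL ϖ 1 hirr.ne_zero one_ne_zero * y * (heckeMat ϖ hirr.ne_zero)⁻¹ ∉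
      Gamma0 (⊤ : Ideal F[X]) := by
  intro h
  obtain ⟨a, b, c, d, hu, hc, rfl⟩ := mem_Gamma0_iff.1 hy
  obtain ⟨a', b', c', d', hu', -, hconj⟩ := mem_Gamma0_iff.1 h
  rw [eq_mul_inv_iff_mul_eq, heckeMat, diagGL_eq_toGL, diagGL_eq_toGL, toGL_mul_toGL_inj] at hconj
  have hd : d' * ϖ = d := by simpa using congrFun₂ hconj 1 1
  refine hirr.not_isUnit (isUnit_of_dvd_unit ?_ hu)
  rw [Matrix.det_fin_two_of, ← hd]
  exact dvd_sub (((dvd_refl ϖ).mul_left _).mul_left _)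
    ((Ideal.mem_span_singleton.1 hc).mul_left _)

theorem mul_inv_mem_Gamma0_mul_span (h0 : ϖ ≠ 0) {r r' : GL (Fin 2) (RatFunc F)}
    (hr : r ∈ DoubleCoset.doubleCoset (heckeMat ϖ h0)
      (Gamma0 (𝔪 * Ideal.span {ϖ}) : Set (GL (Fin 2) (RatFunc F))) (Gamma0 (𝔪 * Ideal.span {ϖ})))
    (hr' : r' ∈ DoubleCoset.doubleCoset (heckeMat ϖ h0)
      (Gamma0 (𝔪 * Ideal.span {ϖ}) : Set (GL (Fin 2) (RatFunc F))) (Gamma0 (𝔪 * Ideal.span {ϖ})))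
    (h : r * r'⁻¹ ∈ Gamma0 𝔪) : r * r'⁻¹ ∈ Gamma0 (𝔪 * Ideal.span {ϖ}) := by
  obtain ⟨x, hx, y, hy, rfl⟩ := DoubleCoset.mem_doubleCoset.1 hr
  obtain ⟨x', hx', y', hy', rfl⟩ := DoubleCoset.mem_doubleCoset.1 hr'
  have hle : Gamma0 (𝔪 * Ideal.span {ϖ}) ≤ Gamma0 𝔪 := Gamma0_mono Ideal.mul_le_left
  have hconj : x * heckeMat ϖ h0 * y * (x' * heckeMat ϖ h0 * y')⁻¹ =
      x * (heckeMat ϖ h0 * (y * y'⁻¹) * (heckeMat ϖ h0)⁻¹) * x'⁻¹ := by group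
  rw [hconj] at h ⊢
  rw [Subgroup.mul_mem_cancel_right _ (inv_mem (hle hx')),
    Subgroup.mul_mem_cancel_left _ (hle hx)] at h
  exact mul_mem (mul_mem hx (heckeMat_conj_mem h0 (hle (mul_mem hy (inv_mem hy')))
    (Gamma0_mono le_top h))) (inv_mem hx')

theorem diagGL_mul_inv_notMem (hirr : Irreducible ϖ) {r : GL (Fin 2) (RatFunc F)}
    (hr : r ∈ DoubleCoset.doubleCoset (heckeMat ϖ hirr.ne_zero)
      (Gamma0 (𝔪 * Ideal.span {ϖ}) : Set (GL (Fin 2) (RatFunc F))) (Gamma0 (𝔪 * Ideal.span {ϖ}))) :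
    diagGL ϖ 1 hirr.ne_zero one_ne_zero * r⁻¹ ∉ Gamma0 𝔪 := by
  obtain ⟨x, hx, y, hy, rfl⟩ := DoubleCoset.mem_doubleCoset.1 hr
  have hconj : diagGL ϖ 1 hirr.ne_zero one_ne_zero * (x * heckeMat ϖ hirr.ne_zero * y)⁻¹ =
      diagGL ϖ 1 hirr.ne_zero one_ne_zero * y⁻¹ * (heckeMat ϖ hirr.ne_zero)⁻¹ * x⁻¹ := by group
  rw [hconj, Subgroup.mul_mem_cancel_right _ (inv_mem (Gamma0_mono Ideal.mul_le_left hx))]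
  exact fun h => diagGL_mul_mul_inv_notMem hirr (inv_mem (Gamma0_mono Ideal.mul_le_right hy))
    (Gamma0_mono le_top h)

theorem IsCosetReps.cons_diagGL (hirr : Irreducible ϖ) (hndvd : ¬ Ideal.span {ϖ} ∣ 𝔪)
    {R : Finset (GL (Fin 2) (RatFunc F))}
    (hR : IsCosetReps (Gamma0 (𝔪 * Ideal.span {ϖ})) (heckeMat ϖ hirr.ne_zero) R) :
    ∃ h, IsCosetReps (Gamma0 𝔪) (heckeMat ϖ hirr.ne_zero)
      (R.cons (diagGL ϖ 1 hirr.ne_zero one_ne_zero) h) := by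
  have hle : Gamma0 (𝔪 * Ideal.span {ϖ}) ≤ Gamma0 𝔪 := Gamma0_mono Ideal.mul_le_left
  have hdiag : ∀ r ∈ R, diagGL ϖ 1 hirr.ne_zero one_ne_zero * r⁻¹ ∉ Gamma0 𝔪 := fun r hr =>
    diagGL_mul_inv_notMem hirr (hR.1 r hr)
  have hcons : diagGL ϖ 1 hirr.ne_zero one_ne_zero ∉ R := fun h => hdiag _ h (by simp)
  refine ⟨hcons, (Finset.forall_mem_cons hcons _).2 ⟨diagGL_mem_doubleCoset hirr hndvd,
    fun r hr => ?_⟩, fun δ hδ => ?_⟩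
  · obtain ⟨x, hx, y, hy, hxy⟩ := DoubleCoset.mem_doubleCoset.1 (hR.1 r hr)
    exact DoubleCoset.mem_doubleCoset.2 ⟨x, hle hx, y, hle hy, hxy⟩
  refine existsUnique_of_exists_of_unique ?_ fun r s hr hs => ?_
  · obtain ⟨x, hx, y, hy, rfl⟩ := DoubleCoset.mem_doubleCoset.1 hδ
    rcases heckeMat_mul_mem_or hirr hy with ⟨α, hα, h⟩ | ⟨α, hα, s, h⟩
    · exact ⟨_, Finset.mem_cons_self _ _, by simpa [mul_assoc, h] using mul_mem hx hα⟩
    · obtain ⟨r, ⟨hr, hsr⟩, -⟩ := hR.2 (heckeMat ϖ hirr.ne_zero * transMat s)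
        (DoubleCoset.mem_doubleCoset.2 ⟨1, one_mem _, _, transMat_mem_Gamma0 _ s, by simp⟩)
      exact ⟨r, Finset.mem_cons_of_mem hr, by
        simpa [mul_assoc, h] using mul_mem hx (mul_mem hα (hle hsr))⟩
  · have hrs : r * s⁻¹ ∈ Gamma0 𝔪 := by simpa using mul_mem (inv_mem hr.2) hs.2
    have hsr : s * r⁻¹ ∈ Gamma0 𝔪 := by simpa using inv_mem hrs
    rcases Finset.mem_cons.1 hr.1 with rfl | hrR <;> rcases Finset.mem_cons.1 hs.1 with rfl | hsR
    · rfl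
    · exact absurd hrs (hdiag s hsR)
    · exact absurd hsr (hdiag r hrR)
    · exact (hR.2 r (hR.1 r hrR)).unique ⟨hrR, by simp⟩
        ⟨hsR, mul_inv_mem_Gamma0_mul_span hirr.ne_zero (hR.1 r hrR) (hR.1 s hsR) hrs⟩

end

section

variable [Fintype F]

/-! ### The stabilizer of `E` under the double slash action -/

/-- The double slash `E ‖_{2,1} γ = E |_{2,1} γ + π⁻¹ c / (c z + d)` of `E`, whose associated
polynomial is `E - π⁻¹ X`. -/
def dslashE (π : CInf F) (γ : GL (Fin 2) (RatFunc F)) : Omega F → CInf F :=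
  slash 2 1 (falseE π) γ + π⁻¹ • kappa γ

theorem slash_falseE (π : CInf F) (γ : GL (Fin 2) (RatFunc F)) :
    slash 2 1 (falseE π) γ = dslashE π γ - π⁻¹ • kappa γ :=
  (add_sub_cancel_right _ _).symm

theorem kappa_eq_zero {γ : GL (Fin 2) (RatFunc F)} (h : γ 1 0 = 0) : kappa γ = 0 := by
  ext z
  simp [kappa, h]

theorem dslashE_one (π : CInf F) : dslashE π 1 = falseE π := by
  rw [dslashE, slash_one, kappa_eq_zero (by simp), smul_zero, add_zero]

theorem dslashE_mul (π : CInf F) (γ δ : GL (Fin 2) (RatFunc F)) :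
    dslashE π (γ * δ) = slash 2 1 (dslashE π γ) δ + π⁻¹ • kappa δ := by
  rw [dslashE, dslashE, slash_mul, kappa_mul, add_slash, smul_slash, smul_add, add_assoc]

/-- The stabilizer of `E` under the double slash action. -/
def stabilizerE (π : CInf F) : Subgroup (GL (Fin 2) (RatFunc F)) where
  carrier := {γ | dslashE π γ = falseE π}
  one_mem' := dslashE_one π
  mul_mem' := by
    intro γ δ (hγ : dslashE π γ = falseE π) (hδ : dslashE π δ = falseE π)
    rw [Set.mem_ofPred_eq, dslashE_mul, hγ]
    exact hδ
  inv_mem' := by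
    intro γ (hγ : dslashE π γ = falseE π)
    rw [Set.mem_ofPred_eq, ← dslashE_one π, ← mul_inv_cancel γ, dslashE_mul, hγ]
    rfl

theorem dslashE_mul_of_mem {π : CInf F} {α : GL (Fin 2) (RatFunc F)} (h : α ∈ stabilizerE π)
    (γ : GL (Fin 2) (RatFunc F)) : dslashE π (α * γ) = dslashE π γ := by
  rw [dslashE_mul, show dslashE π α = falseE π from h, dslashE]

theorem denom_toGL (M : Matrix (Fin 2) (Fin 2) F[X]) (h : M.det ≠ 0) (z : Omega F) :
    denom (toGL M h) z = embA (M 1 0) * z + embA (M 1 1) := rfl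

theorem coe_mob_toGL (M : Matrix (Fin 2) (Fin 2) F[X]) (h : M.det ≠ 0) (z : Omega F) :
    (mob (toGL M h) z : CInf F) =
      (embA (M 0 0) * z + embA (M 0 1)) / (embA (M 1 0) * z + embA (M 1 1)) := rfl

theorem kappa_toGL (M : Matrix (Fin 2) (Fin 2) F[X]) (h : M.det ≠ 0) (z : Omega F) :
    kappa (toGL M h) z = embA (M 1 0) / (embA (M 1 0) * z + embA (M 1 1)) := rfl

theorem detC_toGL (M : Matrix (Fin 2) (Fin 2) F[X]) (h : M.det ≠ 0) :
    detC (toGL M h) = embA M.det :=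
  congrArg embK (RingHom.map_det (algebraMap F[X] (RatFunc F)) M).symm

theorem toGL_upper_mem_stabilizerE (π : CInf F) {x y : F} (hx : x ≠ 0) (hy : y ≠ 0) (b : F[X])
    (h : !![C x, b; 0, C y].det ≠ 0) : toGL !![C x, b; 0, C y] h ∈ stabilizerE π := by
  have hx' : (embA (C x) : CInf F) ≠ 0 := embA_ne_zero (C_ne_zero.2 hx)
  have hy' : (embA (C y) : CInf F) ≠ 0 := embA_ne_zero (C_ne_zero.2 hy)
  have hinv : (embA (C y⁻¹) : CInf F) = (embA (C y))⁻¹ := by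
    refine eq_inv_of_mul_eq_one_left ?_
    rw [← map_mul, ← C_mul, inv_mul_cancel₀ hy, C_1, map_one]
  change dslashE π _ = _
  rw [dslashE, kappa_eq_zero (map_zero (algebraMap F[X] (RatFunc F))), smul_zero, add_zero]
  ext z
  have hden : denom (toGL !![C x, b; 0, C y] h) z = embA (C y) := by simp [denom_toGL]
  have hmob : (mob (toGL !![C x, b; 0, C y] h) z : CInf F) =
      embA (C (x * y⁻¹)) * z + embA (C y⁻¹ * b) := by
    simp only [coe_mob_toGL, Matrix.of_apply, Matrix.cons_val', Matrix.cons_val_zero,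
      Matrix.cons_val_one, Matrix.cons_val_fin_one, map_mul, hinv, map_zero]
    ring
  rw [slash_apply, hden, falseE_C_mul_add π (mul_ne_zero hx (inv_ne_zero hy)) _ hmob, C_mul,
    map_mul, hinv, detC_toGL, Matrix.det_fin_two_of, mul_zero, sub_zero, map_mul, zpow_one,
    zpow_neg, zpow_ofNat]
  field_simp

theorem Gamma0_bot_le_stabilizerE (π : CInf F) : Gamma0 ⊥ ≤ stabilizerE π := by
  intro γ hγ
  obtain ⟨a, b, c, d, h, hc, rfl⟩ := mem_Gamma0_iff.1 hγ
  obtain rfl := (Submodule.mem_bot _).1 hc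
  have hu := h
  rw [Matrix.det_fin_two_of, mul_zero, sub_zero, IsUnit.mul_iff, isUnit_iff, isUnit_iff] at hu
  obtain ⟨⟨x, hx, rfl⟩, ⟨y, hy, rfl⟩⟩ := hu
  exact toGL_upper_mem_stabilizerE π hx.ne_zero hy.ne_zero b _

theorem invMat_mem_stabilizerE (π : CInf F) : invMat F ∈ stabilizerE π := by
  change dslashE π (invMat F) = falseE π
  ext z
  have hz := z.ne_zero
  have hden : denom (invMat F) z = -z := by simp [invMat, denom_toGL]
  have hmob : (mob (invMat F) z : CInf F) = -(z : CInf F)⁻¹ := by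
    simp [invMat, coe_mob_toGL, div_neg]
  have hdet : detC (invMat F) = 1 := by simp [invMat, detC_toGL]
  have hkappa : kappa (invMat F) z = (z : CInf F)⁻¹ := by
    simp [invMat, kappa_toGL, neg_div_neg_eq]
  rw [dslashE, Pi.add_apply, Pi.smul_apply, slash_apply, hden, hdet, hkappa, falseE_neg_inv π hmob,
    smul_eq_mul, one_zpow, even_two.neg.neg_zpow, zpow_neg, zpow_ofNat]
  field_simp
  ring

theorem Gamma0_le_stabilizerE (π : CInf F) (𝔪 : Ideal F[X]) : Gamma0 𝔪 ≤ stabilizerE π :=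
  Gamma0_le_of_bot_le (Gamma0_bot_le_stabilizerE π) (invMat_mem_stabilizerE π) 𝔪

/-! ### Boundedness on vertical lines -/

variable (F) in
/-- The algebra of the functions that are bounded on vertical lines. -/
def boundedOnVerticalLines : Subalgebra (CInf F) (Omega F → CInf F) where
  carrier := {f | BoundedOnVerticalLines f}
  add_mem' := by
    rintro f g ⟨B, R, hf⟩ ⟨B', R', hg⟩
    refine ⟨B + B', max R R', fun z hz => (norm_add_le _ _).trans ?_⟩
    exact add_le_add (hf z ((le_max_left _ _).trans hz)) (hg z ((le_max_right _ _).trans hz))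
  mul_mem' := by
    rintro f g ⟨B, R, hf⟩ ⟨B', R', hg⟩
    refine ⟨B * B', max R R', fun z hz => (norm_mul_le _ _).trans ?_⟩
    have hfz := hf z ((le_max_left _ _).trans hz)
    exact mul_le_mul hfz (hg z ((le_max_right _ _).trans hz)) (norm_nonneg _)
      ((norm_nonneg _).trans hfz)
  algebraMap_mem' c := ⟨‖c‖, 0, fun _ _ => le_rfl⟩

theorem mem_boundedOnVerticalLines {f : Omega F → CInf F} :
    f ∈ boundedOnVerticalLines F ↔ BoundedOnVerticalLines f := Iff.rfl

theorem mem_boundedOnVerticalLines_of_norm_mul_imAbs_le {f : Omega F → CInf F} {B : ℝ}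
    (h : ∀ z, ‖f z‖ * imAbs z ≤ B) : f ∈ boundedOnVerticalLines F :=
  ⟨B, 1, fun z hz => (le_mul_of_one_le_right (norm_nonneg _) hz).trans (h z)⟩

theorem norm_slash_falseE_mul_imAbs_le (π : CInf F) (γ : GL (Fin 2) (RatFunc F)) (z : Omega F) :
    ‖slash 2 1 (falseE π) γ z‖ * imAbs z ≤ ‖π‖⁻¹ := by
  have hw := imAbs_pos (mob γ z)
  have hden : 0 < ‖denom γ z‖ := norm_pos_iff.2 (denom_ne_zero γ z)
  rw [slash_apply, norm_mul, norm_mul, zpow_one, zpow_neg, zpow_ofNat, norm_inv, norm_pow]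
  calc ‖detC γ‖ * (‖denom γ z‖ ^ 2)⁻¹ * ‖falseE π (mob γ z)‖ * imAbs z
      = ‖detC γ‖ * imAbs z * (‖denom γ z‖ ^ 2)⁻¹ * ‖falseE π (mob γ z)‖ := by ring
    _ ≤ imAbs (mob γ z) * ‖denom γ z‖ ^ 2 * (‖denom γ z‖ ^ 2)⁻¹ *
        (‖π‖⁻¹ * (imAbs (mob γ z))⁻¹) := by
      gcongr ?_ * _ * ?_
      · exact norm_detC_mul_imAbs_le γ z
      · exact norm_falseE_le π _
    _ = ‖π‖⁻¹ := by field_simp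

theorem kappa_mem_boundedOnVerticalLines (γ : GL (Fin 2) (RatFunc F)) :
    kappa γ ∈ boundedOnVerticalLines F :=
  mem_boundedOnVerticalLines_of_norm_mul_imAbs_le (norm_kappa_mul_imAbs_le_one γ)

theorem slash_falseE_mem_boundedOnVerticalLines (π : CInf F) (γ : GL (Fin 2) (RatFunc F)) :
    slash 2 1 (falseE π) γ ∈ boundedOnVerticalLines F :=
  mem_boundedOnVerticalLines_of_norm_mul_imAbs_le (norm_slash_falseE_mul_imAbs_le π γ)

theorem dslashE_mem_boundedOnVerticalLines (π : CInf F) (γ : GL (Fin 2) (RatFunc F)) :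
    dslashE π γ ∈ boundedOnVerticalLines F :=
  add_mem (slash_falseE_mem_boundedOnVerticalLines π γ)
    (Subalgebra.smul_mem _ (kappa_mem_boundedOnVerticalLines γ) _)

/-! ### Modular forms -/

variable (F) in
/-- The ring `𝒪` as an algebra over `ℂ_∞`. -/
def ringO : Subalgebra (CInf F) (Omega F → CInf F) where
  carrier := {f | MemO f}
  add_mem' := by
    rintro f g ⟨hf, I, hI, hfI⟩ ⟨hg, J, hJ, hgJ⟩
    refine ⟨hf.add hg, I * J, mul_ne_zero hI hJ, fun a ha z w h => ?_⟩
    obtain ⟨haI, haJ⟩ := Ideal.mul_le_inf ha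
    exact congrArg₂ (· + ·) (hfI a haI z w h) (hgJ a haJ z w h)
  mul_mem' := by
    rintro f g ⟨hf, I, hI, hfI⟩ ⟨hg, J, hJ, hgJ⟩
    refine ⟨hf.mul hg, I * J, mul_ne_zero hI hJ, fun a ha z w h => ?_⟩
    obtain ⟨haI, haJ⟩ := Ideal.mul_le_inf ha
    exact congrArg₂ (· * ·) (hfI a haI z w h) (hgJ a haJ z w h)
  algebraMap_mem' c :=
    ⟨(rigidAnalytic F).algebraMap_mem c, ⊤, top_ne_bot, fun _ _ _ _ _ => rfl⟩

theorem mem_ringO {f : Omega F → CInf F} : f ∈ ringO F ↔ MemO f := Iff.rfl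

theorem isPeriodic_of_slash_transMat {k m : ℤ} {f : Omega F → CInf F}
    (hf : ∀ b, slash k m f (transMat b) = f) : IsPeriodic f := by
  refine ⟨⊤, top_ne_bot, fun b _ z w h => ?_⟩
  have hw : w = mob (transMat b) z := Subtype.ext <| h.trans (by simp [transMat, coe_mob_toGL])
  rw [hw]
  nth_rw 2 [← hf b]
  simp [slash_apply, transMat, detC_toGL, denom_toGL]

theorem falseE_mem_ringO (π : CInf F) : falseE π ∈ ringO F := by
  refine ⟨isRigidAnalytic_falseE π, isPeriodic_of_slash_transMat (k := 2) (m := 1) fun b => ?_⟩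
  have hb : transMat b ∈ stabilizerE π := Gamma0_le_stabilizerE π ⊥ (transMat_mem_Gamma0 ⊥ b)
  rw [slash_falseE, kappa_eq_zero (map_zero (algebraMap F[X] (RatFunc F))), smul_zero, sub_zero]
  exact hb

theorem zero_slash (k m : ℤ) (γ : GL (Fin 2) (RatFunc F)) : slash k m 0 γ = 0 := by
  simpa using smul_slash k m 0 0 γ

theorem isModularForm_iff {𝔪 : Ideal F[X]} {k m : ℤ} {f : Omega F → CInf F} :
    IsModularForm (Gamma0 𝔪) k m f ↔ IsRigidAnalytic f ∧ (∀ γ ∈ Gamma0 𝔪, slash k m f γ = f) ∧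
      ∀ γ, slash k m f γ ∈ boundedOnVerticalLines F := by
  constructor
  · rintro ⟨hr, P, ⟨-, hP⟩, hdeg, hb⟩
    have hslash : ∀ γ ∈ Gamma0 𝔪, slash k m f γ = P.coeff 0 := by
      intro γ hγ
      ext z
      rw [hP γ hγ z, Nat.le_zero.1 hdeg]
      simp
    have hcoeff : f = P.coeff 0 := by rw [← hslash 1 (one_mem _), slash_one]
    refine ⟨hr, fun γ hγ => (hslash γ hγ).trans hcoeff.symm, fun γ => ?_⟩
    simpa [← hcoeff, mem_boundedOnVerticalLines] using hb 0 γ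
  · rintro ⟨hr, hs, hb⟩
    have hO : f ∈ ringO F :=
      ⟨hr, isPeriodic_of_slash_transMat fun b => hs _ (transMat_mem_Gamma0 𝔪 b)⟩
    refine ⟨hr, C f, ⟨fun i => ?_, fun γ hγ z => ?_⟩, by simp, fun i γ => ?_⟩
    · rw [coeff_C]
      split_ifs
      exacts [hO, (ringO F).zero_mem]
    · rw [hs γ hγ]
      simp
    · rcases eq_or_ne i 0 with rfl | hi
      · simpa [mem_boundedOnVerticalLines] using hb γ
      · rw [coeff_C_of_ne_zero hi, zero_slash]
        exact (boundedOnVerticalLines F).zero_mem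

/-- `M_{k,m}(Γ₀(𝔪))` as a space of functions. -/
def modularForms (𝔪 : Ideal F[X]) (k m : ℤ) : Submodule (CInf F) (Omega F → CInf F) where
  carrier := {f | IsModularForm (Gamma0 𝔪) k m f}
  add_mem' := by
    intro f g hf hg
    obtain ⟨hfr, hfs, hfb⟩ := isModularForm_iff.1 hf
    obtain ⟨hgr, hgs, hgb⟩ := isModularForm_iff.1 hg
    refine isModularForm_iff.2 ⟨hfr.add hgr, fun γ hγ => ?_, fun γ => ?_⟩
    · rw [add_slash, hfs γ hγ, hgs γ hγ]
    · exact add_slash k m f g γ ▸ add_mem (hfb γ) (hgb γ)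
  zero_mem' := by
    refine isModularForm_iff.2
      ⟨(rigidAnalytic F).zero_mem, fun γ _ => zero_slash k m γ, fun γ => ?_⟩
    exact (zero_slash k m γ).symm ▸ zero_mem _
  smul_mem' := by
    intro c f hf
    obtain ⟨hfr, hfs, hfb⟩ := isModularForm_iff.1 hf
    refine isModularForm_iff.2
      ⟨(rigidAnalytic F).smul_mem hfr c, fun γ hγ => ?_, fun γ => ?_⟩
    · rw [smul_slash, hfs γ hγ]
    · exact smul_slash k m c f γ ▸ Subalgebra.smul_mem _ (hfb γ) c

/-! ### The associated polynomial -/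

theorem isAssocPoly_iff {Γ : Subgroup (GL (Fin 2) (RatFunc F))} {k m : ℤ}
    {f : Omega F → CInf F} {P : (Omega F → CInf F)[X]} :
    IsAssocPoly Γ k m f P ↔
      (∀ i, P.coeff i ∈ ringO F) ∧ ∀ γ ∈ Γ, slash k m f γ = P.eval (kappa γ) := by
  simp only [IsAssocPoly, mem_ringO, funext_iff, eval_eq_sum_range, Finset.sum_apply, Pi.mul_apply,
    Pi.pow_apply]

theorem infinite_kappa {𝔪 : Ideal F[X]} (h𝔪 : 𝔪 ≠ ⊥) (z : Omega F) :
    {x | ∃ γ ∈ Gamma0 𝔪, kappa γ z = x}.Infinite := by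
  obtain ⟨μ, hμ, hμ0⟩ := Submodule.exists_mem_ne_zero_of_ne_bot h𝔪
  refine Set.infinite_of_injective_forall_mem
    (f := fun n : ℕ => kappa (toGL !![1, 0; X ^ n * μ, 1] (by simp)) z) ?_ fun n =>
      ⟨_, toGL_mem_Gamma0 (by simp) (𝔪.mul_mem_left _ hμ), rfl⟩
  intro n n' h
  have hne : ∀ n, embA (X ^ n * μ) * (z : CInf F) + embA 1 ≠ 0 := fun n =>
    embA_mul_add_ne_zero z (mul_ne_zero (pow_ne_zero _ X_ne_zero) hμ0) 1
  have hc : embA (X ^ n * μ) = (embA (X ^ n' * μ) : CInf F) := by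
    have hdiv : embA (X ^ n * μ) * (embA (X ^ n' * μ) * (z : CInf F) + embA 1) =
        embA (X ^ n' * μ) * (embA (X ^ n * μ) * (z : CInf F) + embA 1) :=
      (div_eq_div_iff (hne n) (hne n')).1 h
    rw [map_one] at hdiv
    linear_combination hdiv
  simpa using congrArg natDegree (mul_right_cancel₀ hμ0 (embA_injective hc))

theorem IsAssocPoly.unique {𝔪 : Ideal F[X]} (h𝔪 : 𝔪 ≠ ⊥) {k m : ℤ} {f : Omega F → CInf F}
    {P P' : (Omega F → CInf F)[X]} (h : IsAssocPoly (Gamma0 𝔪) k m f P)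
    (h' : IsAssocPoly (Gamma0 𝔪) k m f P') : P = P' := by
  have hmap : ∀ z, P.map (Pi.evalRingHom _ z) = P'.map (Pi.evalRingHom _ z) := by
    intro z
    refine eq_of_infinite_eval_eq _ _ ((infinite_kappa h𝔪 z).mono ?_)
    rintro _ ⟨γ, hγ, rfl⟩
    change eval (Pi.evalRingHom (fun _ => CInf F) z (kappa γ)) _ =
      eval (Pi.evalRingHom (fun _ => CInf F) z (kappa γ)) _
    rw [eval_map_apply, eval_map_apply, ← (isAssocPoly_iff.1 h).2 γ hγ,
      ← (isAssocPoly_iff.1 h').2 γ hγ]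
  ext i z
  have hcoeff := congrArg (coeff · i) (hmap z)
  simp only [coeff_map] at hcoeff
  exact hcoeff

theorem IsAssocPoly.assocPoly_eq {𝔪 : Ideal F[X]} (h𝔪 : 𝔪 ≠ ⊥) {k m : ℤ} {f : Omega F → CInf F}
    {P : (Omega F → CInf F)[X]} (h : IsAssocPoly (Gamma0 𝔪) k m f P) :
    assocPoly (Gamma0 𝔪) k m f = P := by
  have hex : ∃ P, IsAssocPoly (Gamma0 𝔪) k m f P := ⟨P, h⟩
  rw [assocPoly, dif_pos hex]
  exact hex.choose_spec.unique h𝔪 h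

/-! ### Polynomials in `E` -/

theorem coeff_comp_linear {R : Type*} [CommRing R] {P : R[X]} {n : ℕ} (hn : P.natDegree ≤ n)
    (g c : R) (i : ℕ) :
    (P.comp (C c * X + C g)).coeff i =
      c ^ i * ∑ h ∈ Finset.range (n + 1), (h.choose i : R) * P.coeff h * g ^ (h - i) := by
  have hcomp : P.comp (C c * X + C g) = (taylor g P).comp (C c * X) := by
    rw [taylor_apply, comp_assoc, add_comp, X_comp, C_comp]
  rw [hcomp, comp_C_mul_X_coeff, mul_comm, taylor_coeff, hasseDeriv_apply,
    sum_over_range' _ (by simp) _ (Nat.lt_succ_of_le hn), eval_finsetSum]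
  simp only [eval_monomial]

theorem coeff_comp_linear_mem {R A : Type*} [CommRing R] [CommRing A] [Algebra R A]
    {S : Subalgebra R A} {P : A[X]} {g : A} (hP : ∀ i, P.coeff i ∈ S) (c : R) (hg : g ∈ S) (i : ℕ) :
    (P.comp (C (algebraMap R A c) * X + C g)).coeff i ∈ S := by
  rw [coeff_comp_linear le_rfl]
  exact mul_mem (pow_mem (S.algebraMap_mem _) _)
    (sum_mem fun h _ => mul_mem (mul_mem (natCast_mem _ _) (hP h)) (pow_mem hg _))

/-- The slash operator on polynomials `∑ f_i X^i`, where `X` has weight `2` and type `1`: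
its `i`-th coefficient is `f_i |_{k-2i,m-i} γ`. -/
def slashPoly (k m : ℤ) (P : (Omega F → CInf F)[X]) (γ : GL (Fin 2) (RatFunc F)) :
    (Omega F → CInf F)[X] :=
  ∑ i ∈ Finset.range (P.natDegree + 1), monomial i (slash (k - 2 * i) (m - i) (P.coeff i) γ)

theorem coeff_slashPoly (k m : ℤ) (P : (Omega F → CInf F)[X]) (γ : GL (Fin 2) (RatFunc F)) (i : ℕ) :
    (slashPoly k m P γ).coeff i = slash (k - 2 * i) (m - i) (P.coeff i) γ := by
  rw [slashPoly, finsetSum_coeff]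
  simp only [coeff_monomial, Finset.sum_ite_eq', Finset.mem_range, Order.lt_add_one_iff]
  rw [ite_eq_left_iff, not_le]
  intro hi
  rw [coeff_eq_zero_of_natDegree_lt hi, zero_slash]

theorem natDegree_slashPoly_le (k m : ℤ) (P : (Omega F → CInf F)[X])
    (γ : GL (Fin 2) (RatFunc F)) : (slashPoly k m P γ).natDegree ≤ P.natDegree := by
  refine natDegree_le_iff_coeff_eq_zero.2 fun i hi => ?_
  rw [coeff_slashPoly, coeff_eq_zero_of_natDegree_lt hi, zero_slash]

theorem eval_slash (k m : ℤ) (P : (Omega F → CInf F)[X]) (g : Omega F → CInf F)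
    (γ : GL (Fin 2) (RatFunc F)) :
    slash k m (P.eval g) γ = (slashPoly k m P γ).eval (slash 2 1 g γ) := by
  rw [eval_eq_sum_range, sum_slash,
    eval_eq_sum_range' (Nat.lt_succ_of_le (natDegree_slashPoly_le k m P γ))]
  refine Finset.sum_congr rfl fun i _ => ?_
  rw [mul_pow_slash k m 2 1, coeff_slashPoly, mul_comm 2, mul_one]

theorem slashPoly_comp_linear (k m : ℤ) (P : (Omega F → CInf F)[X]) (g : Omega F → CInf F)
    (c : CInf F) (γ : GL (Fin 2) (RatFunc F)) :
    slashPoly k m (P.comp (C (algebraMap (CInf F) _ c) * X + C g)) γ =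
      (slashPoly k m P γ).comp (C (algebraMap (CInf F) _ c) * X + C (slash 2 1 g γ)) := by
  ext1 i
  rw [coeff_slashPoly, coeff_comp_linear le_rfl,
    coeff_comp_linear (natDegree_slashPoly_le k m P γ), ← map_pow, ← Algebra.smul_def,
    ← Algebra.smul_def, smul_slash, sum_slash]
  refine congrArg _ (Finset.sum_congr rfl fun h _ => ?_)
  rcases lt_or_ge h i with hi | hi
  · simp [Nat.choose_eq_zero_of_lt hi, zero_slash]
  have hw : k - 2 * i - (h - i : ℕ) * 2 = k - 2 * h := by
    push_cast [hi]
    ring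
  have ht : m - i - (h - i : ℕ) * 1 = m - h := by
    push_cast [hi]
    ring
  rw [mul_assoc, mul_assoc, ← nsmul_eq_mul, ← nsmul_eq_mul, ← Nat.cast_smul_eq_nsmul (CInf F),
    ← Nat.cast_smul_eq_nsmul (CInf F), smul_slash, mul_pow_slash _ _ 2 1, hw, ht, coeff_slashPoly]

/-- `Q(E - π⁻¹ X)`, the associated polynomial of `Q(E)` when the coefficients of `Q` are modular
forms. -/
def eSubst (π : CInf F) (Q : (Omega F → CInf F)[X]) : (Omega F → CInf F)[X] :=
  Q.comp (C (algebraMap (CInf F) _ (-π⁻¹)) * X + C (falseE π))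

theorem natDegree_eSubst_le (π : CInf F) (Q : (Omega F → CInf F)[X]) :
    (eSubst π Q).natDegree ≤ Q.natDegree :=
  natDegree_comp_le.trans (mul_le_of_le_one_right' natDegree_linear_le)

theorem eCoeff_eq_coeff_comp (π : CInf F) (Γ : Subgroup (GL (Fin 2) (RatFunc F))) (k m : ℤ)
    (f : Omega F → CInf F) (i : ℕ) :
    eCoeff π Γ k m f i = ((assocPoly Γ k m f).comp
      (C (algebraMap (CInf F) _ (-π)) * X + C (π • falseE π))).coeff i := by
  rw [coeff_comp_linear le_rfl]
  ext z
  have hIcc : Finset.Icc i (assocPoly Γ k m f).natDegree ⊆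
      Finset.range ((assocPoly Γ k m f).natDegree + 1) := fun h hh =>
    Finset.mem_range_succ_iff.2 (Finset.mem_Icc.1 hh).2
  simp only [Pi.mul_apply, Pi.pow_apply, Finset.sum_apply, Pi.algebraMap_apply,
    Algebra.algebraMap_self, RingHom.id_apply, Pi.natCast_apply, Pi.smul_apply, smul_eq_mul, eCoeff]
  refine congrArg _ (Finset.sum_subset hIcc fun h hh hi => ?_)
  have hlt : h < i := by
    simp only [Finset.mem_range, Finset.mem_Icc] at hh hi
    lia
  simp [Nat.choose_eq_zero_of_lt hlt]

theorem eSubst_comp {π : CInf F} (hπ : π ≠ 0) (Q : (Omega F → CInf F)[X]) :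
    (eSubst π Q).comp (C (algebraMap (CInf F) _ (-π)) * X + C (π • falseE π)) = Q := by
  have hlin : (C (algebraMap (CInf F) (Omega F → CInf F) (-π⁻¹)) * X + C (falseE π)).comp
      (C (algebraMap (CInf F) _ (-π)) * X + C (π • falseE π)) = X := by
    have hinv : algebraMap (CInf F) (Omega F → CInf F) π⁻¹ * algebraMap (CInf F) _ π = 1 := by
      rw [← map_mul, inv_mul_cancel₀ hπ, map_one]
    have hinv' := congrArg C hinv
    rw [C_mul, C_1] at hinv'
    simp only [add_comp, mul_comp, C_comp, X_comp, Algebra.smul_def, map_neg, C_mul, neg_comp]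
    linear_combination (X - C (falseE π)) * hinv'
  rw [eSubst, comp_assoc, hlin, comp_X]

section EvalFalseE

variable {𝔪 : Ideal F[X]} {k m : ℤ} {Q : (Omega F → CInf F)[X]}

theorem slashPoly_eq_self (hQ : ∀ i : ℕ, IsModularForm (Gamma0 𝔪) (k - 2 * i) (m - i) (Q.coeff i))
    {γ : GL (Fin 2) (RatFunc F)} (hγ : γ ∈ Gamma0 𝔪) : slashPoly k m Q γ = Q := by
  ext1 i
  rw [coeff_slashPoly, (isModularForm_iff.1 (hQ i)).2.1 γ hγ]

theorem isAssocPoly_eSubst (π : CInf F)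
    (hQ : ∀ i : ℕ, IsModularForm (Gamma0 𝔪) (k - 2 * i) (m - i) (Q.coeff i)) :
    IsAssocPoly (Gamma0 𝔪) k m (Q.eval (falseE π)) (eSubst π Q) := by
  have hO : ∀ i, Q.coeff i ∈ ringO F := fun i =>
    ⟨(isModularForm_iff.1 (hQ i)).1, isPeriodic_of_slash_transMat fun b =>
      (isModularForm_iff.1 (hQ i)).2.1 _ (transMat_mem_Gamma0 𝔪 b)⟩
  refine isAssocPoly_iff.2
    ⟨coeff_comp_linear_mem (S := ringO F) hO _ (falseE_mem_ringO π), fun γ hγ => ?_⟩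
  have hE : dslashE π γ = falseE π := Gamma0_le_stabilizerE π 𝔪 hγ
  rw [eval_slash, slashPoly_eq_self hQ hγ, slash_falseE, hE, eSubst, eval_comp]
  simp [Algebra.smul_def, sub_eq_neg_add]

theorem isQuasiModularForm_eval (π : CInf F)
    (hQ : ∀ i : ℕ, IsModularForm (Gamma0 𝔪) (k - 2 * i) (m - i) (Q.coeff i)) {n : ℕ}
    (hn : Q.natDegree ≤ n) : IsQuasiModularForm (Gamma0 𝔪) k m n (Q.eval (falseE π)) := by
  refine ⟨?_, eSubst π Q, isAssocPoly_eSubst π hQ, (natDegree_eSubst_le π Q).trans hn,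
    fun i γ => ?_⟩
  · rw [eval_eq_sum_range]
    exact sum_mem (S := rigidAnalytic F) fun i _ =>
      mul_mem (isModularForm_iff.1 (hQ i)).1 (pow_mem (isRigidAnalytic_falseE π) i)
  · rw [← coeff_slashPoly, eSubst, slashPoly_comp_linear]
    refine coeff_comp_linear_mem (S := boundedOnVerticalLines F) (fun j => ?_) _
      (slash_falseE_mem_boundedOnVerticalLines π γ) i
    rw [coeff_slashPoly]
    exact (isModularForm_iff.1 (hQ j)).2.2 γ

theorem doubleSlash_eval (h𝔪 : 𝔪 ≠ ⊥) (π : CInf F)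
    (hQ : ∀ i : ℕ, IsModularForm (Gamma0 𝔪) (k - 2 * i) (m - i) (Q.coeff i))
    (γ : GL (Fin 2) (RatFunc F)) :
    doubleSlash (Gamma0 𝔪) k m (Q.eval (falseE π)) γ =
      (slashPoly k m Q γ).eval (dslashE π γ) := by
  have heval : doubleSlash (Gamma0 𝔪) k m (Q.eval (falseE π)) γ =
      (slashPoly k m (eSubst π Q) γ).eval (-kappa γ) := by
    rw [eval_eq_sum_range' (Nat.lt_succ_of_le (natDegree_slashPoly_le k m _ γ))]
    ext z
    simp only [doubleSlash, (isAssocPoly_eSubst π hQ).assocPoly_eq h𝔪, Finset.sum_apply,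
      coeff_slashPoly, Pi.mul_apply, Pi.pow_apply, Pi.neg_apply, mul_comm]
  rw [heval, eSubst, slashPoly_comp_linear, eval_comp, slash_falseE]
  simp [Algebra.smul_def]

theorem hasEExpansion_eval (h𝔪 : 𝔪 ≠ ⊥) {π : CInf F} (hπ : π ≠ 0)
    (hQ : ∀ i : ℕ, IsModularForm (Gamma0 𝔪) (k - 2 * i) (m - i) (Q.coeff i)) {n : ℕ}
    (hn : Q.natDegree ≤ n) :
    HasEExpansion π (Gamma0 𝔪) k m n (Q.eval (falseE π)) Q.coeff where
  isQuasiModularForm := isQuasiModularForm_eval π hQ hn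
  coeff_eq i _ := by
    rw [eCoeff_eq_coeff_comp, (isAssocPoly_eSubst π hQ).assocPoly_eq h𝔪, eSubst_comp hπ]
  coeff_isModularForm i _ := hQ i
  eq_sum z := by
    rw [eval_eq_sum_range' (Nat.lt_succ_of_le hn)]
    simp

end EvalFalseE

/-! ### The stabilization `E_𝔭` -/

theorem isRigidAnalytic_dslashE (π : CInf F) (γ : GL (Fin 2) (RatFunc F)) :
    IsRigidAnalytic (dslashE π γ) :=
  ((isRigidAnalytic_falseE π).slash 2 1 γ).add <| (rigidAnalytic F).smul_mem
    (isRigidAnalytic_of_mem_rationalOn fun _ => kappa_mem_rationalOn γ) π⁻¹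

theorem detC_diagGL (a d : F[X]) (ha : a ≠ 0) (hd : d ≠ 0) :
    detC (diagGL a d ha hd) = embA a * embA d := by
  rw [diagGL_eq_toGL, detC_toGL, Matrix.det_fin_two_of, mul_zero, sub_zero, map_mul]

theorem detC_heckeMat {ϖ : F[X]} (h0 : ϖ ≠ 0) : detC (heckeMat ϖ h0) = embA ϖ := by
  rw [heckeMat, detC_diagGL, map_one, one_mul]

theorem slash_diagGL (k m : ℤ) (f : Omega F → CInf F) {ϖ : F[X]} (h0 : ϖ ≠ 0) :
    slash k m f (diagGL ϖ 1 h0 one_ne_zero) = embA ϖ ^ m • degeneracy ϖ h0 f := by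
  ext z
  have hden : denom (diagGL ϖ 1 h0 one_ne_zero) z = 1 := by simp [diagGL_eq_toGL, denom_toGL]
  rw [slash_apply, detC_diagGL, hden, map_one, mul_one, one_zpow, mul_one]
  rfl

theorem dslashE_diagGL (π : CInf F) {ϖ : F[X]} (h0 : ϖ ≠ 0) :
    dslashE π (diagGL ϖ 1 h0 one_ne_zero) = falseE π - stabE π ϖ h0 := by
  rw [dslashE, kappa_eq_zero (by simp [diagGL_eq_toGL, toGL_apply]), slash_diagGL, zpow_one,
    smul_zero, add_zero]
  ext z
  exact (sub_sub_cancel _ _).symm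

theorem slash_stabE (π : CInf F) {ϖ : F[X]} (h0 : ϖ ≠ 0) (γ : GL (Fin 2) (RatFunc F)) :
    slash 2 1 (stabE π ϖ h0) γ = dslashE π γ - dslashE π (diagGL ϖ 1 h0 one_ne_zero * γ) := by
  rw [dslashE_mul, dslashE_diagGL, sub_slash, dslashE]
  abel

theorem diagGL_mul_heckeMat_mem_stabilizerE (π : CInf F) {ϖ : F[X]} (h0 : ϖ ≠ 0) :
    diagGL ϖ 1 h0 one_ne_zero * heckeMat ϖ h0 ∈ stabilizerE π := by
  have hϖ : (embA ϖ : CInf F) ≠ 0 := embA_ne_zero h0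
  have hdet : (!![ϖ, 0; 0, ϖ] : Matrix (Fin 2) (Fin 2) F[X]).det ≠ 0 := by simp [h0]
  have hscalar : diagGL ϖ 1 h0 one_ne_zero * heckeMat ϖ h0 = toGL !![ϖ, 0; 0, ϖ] hdet := by
    rw [heckeMat, diagGL_eq_toGL, diagGL_eq_toGL, ← toGL_mul _ _ _ _ (by simp [h0])]
    congr 1
    simp
  rw [hscalar]
  change dslashE π _ = falseE π
  rw [dslashE, kappa_eq_zero (map_zero (algebraMap F[X] (RatFunc F))), smul_zero, add_zero]
  ext z
  have hmob : mob (toGL !![ϖ, 0; 0, ϖ] hdet) z = z :=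
    Subtype.ext (by simp [coe_mob_toGL, mul_div_cancel_left₀ _ hϖ])
  have hden : denom (toGL !![ϖ, 0; 0, ϖ] hdet) z = embA ϖ := by simp [denom_toGL]
  rw [slash_apply, hmob, hden, detC_toGL, Matrix.det_fin_two_of, mul_zero, sub_zero, map_mul,
    zpow_one, zpow_neg, zpow_ofNat]
  field_simp

theorem slash_stabE_of_mem (π : CInf F) {𝔪 : Ideal F[X]} {ϖ : F[X]} (h0 : ϖ ≠ 0)
    {γ : GL (Fin 2) (RatFunc F)} (hγ : γ ∈ Gamma0 (𝔪 * Ideal.span {ϖ})) :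
    slash 2 1 (stabE π ϖ h0) γ = stabE π ϖ h0 := by
  obtain ⟨γ', hγ', h⟩ := exists_diagGL_mul_eq h0 hγ
  have hE : dslashE π γ = falseE π := Gamma0_le_stabilizerE π _ hγ
  rw [slash_stabE, h, dslashE_mul_of_mem (Gamma0_le_stabilizerE π _ hγ'), hE, dslashE_diagGL,
    sub_sub_cancel]

theorem slash_stabE_of_mem_doubleCoset (π : CInf F) {𝔪 : Ideal F[X]} {ϖ : F[X]} (h0 : ϖ ≠ 0)
    {γ : GL (Fin 2) (RatFunc F)} (hγ : γ ∈ DoubleCoset.doubleCoset (heckeMat ϖ h0)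
      (Gamma0 (𝔪 * Ideal.span {ϖ}) : Set (GL (Fin 2) (RatFunc F)))
      (Gamma0 (𝔪 * Ideal.span {ϖ}))) :
    slash 2 1 (stabE π ϖ h0) γ = dslashE π γ - falseE π := by
  obtain ⟨x, hx, y, hy, rfl⟩ := DoubleCoset.mem_doubleCoset.1 hγ
  obtain ⟨x', hx', h⟩ := exists_diagGL_mul_eq h0 hx
  have hassoc : diagGL ϖ 1 h0 one_ne_zero * (x * heckeMat ϖ h0 * y) =
      x' * (diagGL ϖ 1 h0 one_ne_zero * heckeMat ϖ h0 * y) := by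
    simp only [← mul_assoc, h]
  have hy' : dslashE π y = falseE π := Gamma0_le_stabilizerE π _ hy
  rw [slash_stabE, hassoc, dslashE_mul_of_mem (Gamma0_le_stabilizerE π _ hx'),
    dslashE_mul_of_mem (diagGL_mul_heckeMat_mem_stabilizerE π h0), hy']

theorem slash_mul_pow (k m : ℤ) (f g : Omega F → CInf F) (j : ℕ) (γ : GL (Fin 2) (RatFunc F)) :
    slash (k + 2 * j) (m + j) (f * g ^ j) γ = slash k m f γ * slash 2 1 g γ ^ j := by
  rw [mul_pow_slash _ _ 2 1, mul_one, mul_comm (j : ℤ), add_sub_cancel_right, add_sub_cancel_right]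

theorem IsModularForm.mul_stabE_pow {𝔪 : Ideal F[X]} {k m : ℤ} {f : Omega F → CInf F}
    (hf : IsModularForm (Gamma0 𝔪) k m f) (π : CInf F) {ϖ : F[X]} (h0 : ϖ ≠ 0) (j : ℕ) :
    IsModularForm (Gamma0 (𝔪 * Ideal.span {ϖ})) (k + 2 * j) (m + j) (f * stabE π ϖ h0 ^ j) := by
  obtain ⟨hr, hs, hb⟩ := isModularForm_iff.1 hf
  refine isModularForm_iff.2 ⟨?_, fun γ hγ => ?_, fun γ => ?_⟩
  · have hE : stabE π ϖ h0 ∈ rigidAnalytic F := by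
      rw [← sub_sub_cancel (falseE π) (stabE π ϖ h0), ← dslashE_diagGL]
      exact sub_mem (isRigidAnalytic_falseE π) (isRigidAnalytic_dslashE π _)
    exact hr.mul (pow_mem hE j)
  · rw [slash_mul_pow, hs γ (Gamma0_mono Ideal.mul_le_left hγ), slash_stabE_of_mem π h0 hγ]
  · rw [slash_mul_pow, slash_stabE]
    exact mul_mem (hb γ) (pow_mem (sub_mem (dslashE_mem_boundedOnVerticalLines π _)
      (dslashE_mem_boundedOnVerticalLines π _)) j)

/-! ### Hecke operators -/

section HeckeOperator

variable {𝔪 : Ideal F[X]} {k m : ℤ} {f : Omega F → CInf F} {n : ℕ}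

theorem isModularForm_coeff_monomial (hf : IsModularForm (Gamma0 𝔪) (k - 2 * n) (m - n) f) (i : ℕ) :
    IsModularForm (Gamma0 𝔪) (k - 2 * i) (m - i) ((monomial n f).coeff i) := by
  rw [coeff_monomial]
  split_ifs with h
  · exact h ▸ hf
  · exact (modularForms 𝔪 _ _).zero_mem

theorem slashPoly_monomial (k m : ℤ) (f : Omega F → CInf F) (n : ℕ)
    (γ : GL (Fin 2) (RatFunc F)) :
    slashPoly k m (monomial n f) γ = monomial n (slash (k - 2 * n) (m - n) f γ) := by
  ext1 i
  rw [coeff_slashPoly, coeff_monomial, coeff_monomial]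
  split_ifs with h
  · rw [h]
  · exact zero_slash _ _ γ

theorem isQuasiModularForm_mul_falseE_pow
    (hf : IsModularForm (Gamma0 𝔪) (k - 2 * n) (m - n) f) (π : CInf F) :
    IsQuasiModularForm (Gamma0 𝔪) k m n (f * falseE π ^ n) := by
  rw [← eval_monomial]
  exact isQuasiModularForm_eval π (isModularForm_coeff_monomial hf) (natDegree_monomial_le f)

theorem doubleSlash_mul_falseE_pow (h𝔪 : 𝔪 ≠ ⊥)
    (hf : IsModularForm (Gamma0 𝔪) (k - 2 * n) (m - n) f) (π : CInf F)
    (γ : GL (Fin 2) (RatFunc F)) :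
    doubleSlash (Gamma0 𝔪) k m (f * falseE π ^ n) γ =
      slash (k - 2 * n) (m - n) f γ * dslashE π γ ^ n := by
  rw [← eval_monomial, doubleSlash_eval h𝔪 π (isModularForm_coeff_monomial hf), slashPoly_monomial,
    eval_monomial]

theorem IsModularForm.doubleSlash_eq (hf : IsModularForm (Gamma0 𝔪) k m f) (h𝔪 : 𝔪 ≠ ⊥)
    (γ : GL (Fin 2) (RatFunc F)) : doubleSlash (Gamma0 𝔪) k m f γ = slash k m f γ := by
  simpa using doubleSlash_mul_falseE_pow (n := 0) h𝔪 (by simpa using hf) 0 γ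

theorem hecke_eq (Γ : Subgroup (GL (Fin 2) (RatFunc F))) (η : GL (Fin 2) (RatFunc F))
    (R : Finset (GL (Fin 2) (RatFunc F))) (k m : ℤ) (f : Omega F → CInf F) :
    hecke Γ η R k m f = detC η ^ (k - m) • ∑ γ ∈ R, doubleSlash Γ k m f γ := by
  ext z
  simp only [Pi.smul_apply, Finset.sum_apply, smul_eq_mul]
  rfl

/-- The contribution `f |_{k,m} γ · (E ‖ γ - E)^j` of the representative `γ` to the coefficients of
the `E`-expansion of a Hecke operator. -/
def heckeTerm (π : CInf F) (k m : ℤ) (j : ℕ) (f : Omega F → CInf F)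
    (γ : GL (Fin 2) (RatFunc F)) : Omega F → CInf F :=
  slash k m f γ * (dslashE π γ - falseE π) ^ j

theorem heckeTerm_mul_left (hf : IsModularForm (Gamma0 𝔪) k m f) (π : CInf F) (j : ℕ)
    {α : GL (Fin 2) (RatFunc F)} (hα : α ∈ Gamma0 𝔪) (γ : GL (Fin 2) (RatFunc F)) :
    heckeTerm π k m j f (α * γ) = heckeTerm π k m j f γ := by
  rw [heckeTerm, slash_mul, (isModularForm_iff.1 hf).2.1 α hα,
    dslashE_mul_of_mem (Gamma0_le_stabilizerE π 𝔪 hα), heckeTerm]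

theorem slash_heckeTerm (π : CInf F) (k m : ℤ) (j : ℕ) (f : Omega F → CInf F)
    (γ δ : GL (Fin 2) (RatFunc F)) :
    slash (k + 2 * j) (m + j) (heckeTerm π k m j f γ) δ =
      slash k m f (γ * δ) * (dslashE π (γ * δ) - dslashE π δ) ^ j := by
  rw [heckeTerm, slash_mul_pow, slash_mul, sub_slash, dslashE_mul, slash_falseE, sub_sub_eq_add_sub]

theorem isRigidAnalytic_heckeTerm (hf : IsRigidAnalytic f) (π : CInf F) (k m : ℤ) (j : ℕ)
    (γ : GL (Fin 2) (RatFunc F)) : IsRigidAnalytic (heckeTerm π k m j f γ) :=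
  (hf.slash k m γ).mul <| pow_mem (S := rigidAnalytic F)
    (sub_mem (isRigidAnalytic_dslashE π γ) (isRigidAnalytic_falseE π)) j

theorem sum_heckeTerm_mem_modularForms (hf : IsModularForm (Gamma0 𝔪) k m f) (π : CInf F) (j : ℕ)
    {η : GL (Fin 2) (RatFunc F)} {R : Finset (GL (Fin 2) (RatFunc F))}
    (hR : IsCosetReps (Gamma0 𝔪) η R) :
    ∑ γ ∈ R, heckeTerm π k m j f γ ∈ modularForms 𝔪 (k + 2 * j) (m + j) := by
  obtain ⟨hr, -, hb⟩ := isModularForm_iff.1 hf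
  refine isModularForm_iff.2
    ⟨sum_mem (S := rigidAnalytic F) fun γ _ => isRigidAnalytic_heckeTerm hr π k m j γ,
      fun δ hδ => ?_, fun δ => ?_⟩
  · have hE : dslashE π δ = falseE π := Gamma0_le_stabilizerE π 𝔪 hδ
    simp only [sum_slash, slash_heckeTerm, hE]
    rw [← (hR.map_mulRight hδ).sum_eq hR fun α hα γ => heckeTerm_mul_left hf π j hα γ,
      Finset.sum_map]
    rfl
  · simp only [sum_slash, slash_heckeTerm]
    exact sum_mem fun γ _ => mul_mem (hb _) <| pow_mem (sub_mem
      (dslashE_mem_boundedOnVerticalLines π _) (dslashE_mem_boundedOnVerticalLines π _)) j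

/-- The polynomial over the functions on `Ω` whose value at `E` is `T_η (f E^n)`, for `f` modular
of weight `k - 2n` and type `m - n`. -/
def heckePoly (π : CInf F) (η : GL (Fin 2) (RatFunc F)) (R : Finset (GL (Fin 2) (RatFunc F)))
    (k m : ℤ) (n : ℕ) (f : Omega F → CInf F) : (Omega F → CInf F)[X] :=
  detC η ^ (k - m) •
    ∑ γ ∈ R, C (slash (k - 2 * n) (m - n) f γ) * (X + C (dslashE π γ - falseE π)) ^ n

theorem coeff_heckePoly (π : CInf F) (η : GL (Fin 2) (RatFunc F))
    (R : Finset (GL (Fin 2) (RatFunc F))) (k m : ℤ) (n : ℕ) (f : Omega F → CInf F) (i : ℕ) :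
    (heckePoly π η R k m n f).coeff i = ((n.choose i : CInf F) * detC η ^ (k - m)) •
      ∑ γ ∈ R, heckeTerm π (k - 2 * n) (m - n) (n - i) f γ := by
  simp only [heckePoly, coeff_smul, finsetSum_coeff, coeff_C_mul, coeff_X_add_C_pow, heckeTerm,
    mul_comm _ (detC η ^ (k - m)), mul_smul, ← mul_assoc, ← Finset.sum_mul]
  rw [Nat.cast_smul_eq_nsmul, nsmul_eq_mul, mul_comm]

theorem natDegree_heckePoly_le (π : CInf F) (η : GL (Fin 2) (RatFunc F))
    (R : Finset (GL (Fin 2) (RatFunc F))) (k m : ℤ) (n : ℕ) (f : Omega F → CInf F) :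
    (heckePoly π η R k m n f).natDegree ≤ n := by
  refine natDegree_le_iff_coeff_eq_zero.2 fun i hi => ?_
  rw [coeff_heckePoly, Nat.choose_eq_zero_of_lt hi, Nat.cast_zero, zero_mul, zero_smul]

theorem hecke_mul_falseE_pow (h𝔪 : 𝔪 ≠ ⊥)
    (hf : IsModularForm (Gamma0 𝔪) (k - 2 * n) (m - n) f) (π : CInf F)
    (η : GL (Fin 2) (RatFunc F)) (R : Finset (GL (Fin 2) (RatFunc F))) :
    hecke (Gamma0 𝔪) η R k m (f * falseE π ^ n) = (heckePoly π η R k m n f).eval (falseE π) := by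
  simp only [hecke_eq, doubleSlash_mul_falseE_pow h𝔪 hf, heckePoly, eval_smul, eval_finsetSum,
    eval_mul, eval_C, eval_pow, eval_add, eval_X, add_sub_cancel]

theorem isModularForm_coeff_heckePoly (hf : IsModularForm (Gamma0 𝔪) (k - 2 * n) (m - n) f)
    (π : CInf F) {η : GL (Fin 2) (RatFunc F)} {R : Finset (GL (Fin 2) (RatFunc F))}
    (hR : IsCosetReps (Gamma0 𝔪) η R) (i : ℕ) :
    IsModularForm (Gamma0 𝔪) (k - 2 * i) (m - i) ((heckePoly π η R k m n f).coeff i) := by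
  rcases le_or_gt i n with hi | hi
  · have hk : k - 2 * n + 2 * (n - i : ℕ) = k - 2 * i := by lia
    have hm : m - n + (n - i : ℕ) = m - i := by lia
    rw [coeff_heckePoly, ← hk, ← hm]
    exact (modularForms 𝔪 _ _).smul_mem _ (sum_heckeTerm_mem_modularForms hf π _ hR)
  · rw [coeff_eq_zero_of_natDegree_lt ((natDegree_heckePoly_le π η R k m n f).trans_lt hi)]
    exact (modularForms 𝔪 _ _).zero_mem

theorem HasEExpansion.congr {π : CInf F} {Γ : Subgroup (GL (Fin 2) (RatFunc F))}
    {c c' : ℕ → Omega F → CInf F} (hc : HasEExpansion π Γ k m n f c) (h : ∀ i ≤ n, c i = c' i) :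
    HasEExpansion π Γ k m n f c' where
  isQuasiModularForm := hc.isQuasiModularForm
  coeff_eq i hi := h i hi ▸ hc.coeff_eq i hi
  coeff_isModularForm i hi := h i hi ▸ hc.coeff_isModularForm i hi
  eq_sum z := (hc.eq_sum z).trans <| Finset.sum_congr rfl fun i hi => by
    rw [h i (Finset.mem_range_succ_iff.1 hi)]

theorem hasEExpansion_hecke (h𝔪 : 𝔪 ≠ ⊥) {π : CInf F} (hπ : π ≠ 0)
    (hf : IsModularForm (Gamma0 𝔪) (k - 2 * n) (m - n) f)
    {η : GL (Fin 2) (RatFunc F)} {R : Finset (GL (Fin 2) (RatFunc F))}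
    (hR : IsCosetReps (Gamma0 𝔪) η R) :
    HasEExpansion π (Gamma0 𝔪) k m n (hecke (Gamma0 𝔪) η R k m (f * falseE π ^ n))
      (heckePoly π η R k m n f).coeff := by
  rw [hecke_mul_falseE_pow h𝔪 hf]
  exact hasEExpansion_eval h𝔪 hπ (isModularForm_coeff_heckePoly hf π hR)
    (natDegree_heckePoly_le π η R k m n f)

end HeckeOperator

section HeckePrime

variable {𝔪 : Ideal F[X]} {ϖ : F[X]} {k m : ℤ} {f : Omega F → CInf F}

theorem heckeTerm_diagGL (π : CInf F) (k m : ℤ) (j : ℕ) (f : Omega F → CInf F) (h0 : ϖ ≠ 0) :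
    heckeTerm π k m j f (diagGL ϖ 1 h0 one_ne_zero) =
      embA ϖ ^ m • (degeneracy ϖ h0 f * (-stabE π ϖ h0) ^ j) := by
  rw [heckeTerm, slash_diagGL, dslashE_diagGL, sub_sub_cancel_left, smul_mul_assoc]

theorem heckeTerm_of_mem_doubleCoset (π : CInf F) (k m : ℤ) (j : ℕ) (f : Omega F → CInf F)
    (h0 : ϖ ≠ 0) {γ : GL (Fin 2) (RatFunc F)}
    (hγ : γ ∈ DoubleCoset.doubleCoset (heckeMat ϖ h0)
      (Gamma0 (𝔪 * Ideal.span {ϖ}) : Set (GL (Fin 2) (RatFunc F)))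
      (Gamma0 (𝔪 * Ideal.span {ϖ}))) :
    heckeTerm π k m j f γ = slash (k + 2 * j) (m + j) (f * stabE π ϖ h0 ^ j) γ := by
  rw [slash_mul_pow, slash_stabE_of_mem_doubleCoset π h0 hγ, heckeTerm]

theorem sum_heckeTerm_eq (hf : IsModularForm (Gamma0 𝔪) k m f) (π : CInf F) (j : ℕ)
    (hirr : Irreducible ϖ) (hndvd : ¬ Ideal.span {ϖ} ∣ 𝔪)
    {RT RU : Finset (GL (Fin 2) (RatFunc F))}
    (hRT : IsCosetReps (Gamma0 𝔪) (heckeMat ϖ hirr.ne_zero) RT)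
    (hRU : IsCosetReps (Gamma0 (𝔪 * Ideal.span {ϖ})) (heckeMat ϖ hirr.ne_zero) RU) :
    ∑ γ ∈ RT, heckeTerm π k m j f γ =
      embA ϖ ^ m • (degeneracy ϖ hirr.ne_zero f * (-stabE π ϖ hirr.ne_zero) ^ j) +
        ∑ γ ∈ RU, slash (k + 2 * j) (m + j) (f * stabE π ϖ hirr.ne_zero ^ j) γ := by
  obtain ⟨hcons, hR⟩ := hRU.cons_diagGL hirr hndvd
  rw [hRT.sum_eq hR fun α hα γ => heckeTerm_mul_left hf π j hα γ, Finset.sum_cons, heckeTerm_diagGL]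
  exact congrArg _ (Finset.sum_congr rfl fun γ hγ =>
    heckeTerm_of_mem_doubleCoset π k m j f hirr.ne_zero (hRU.1 γ hγ))

theorem hecke_mul_stabE_pow (h𝔪 : 𝔪 ≠ ⊥) (hf : IsModularForm (Gamma0 𝔪) k m f) (π : CInf F)
    (j : ℕ) (h0 : ϖ ≠ 0) (R : Finset (GL (Fin 2) (RatFunc F))) :
    hecke (Gamma0 (𝔪 * Ideal.span {ϖ})) (heckeMat ϖ h0) R (k + 2 * j) (m + j)
      (f * stabE π ϖ h0 ^ j) = embA ϖ ^ (k - m + j) •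
        ∑ γ ∈ R, slash (k + 2 * j) (m + j) (f * stabE π ϖ h0 ^ j) γ := by
  have h𝔪' : 𝔪 * Ideal.span {ϖ} ≠ ⊥ := mul_ne_zero h𝔪 (by simpa using h0)
  simp only [hecke_eq, (hf.mul_stabE_pow π h0 j).doubleSlash_eq h𝔪', detC_heckeMat]
  congr 2
  ring

theorem coeff_heckePoly_heckeMat {n h : ℕ} (hn : h ≤ n) (h𝔪 : 𝔪 ≠ ⊥)
    (hf : IsModularForm (Gamma0 𝔪) (k - 2 * n) (m - n) f) (π : CInf F)
    (hirr : Irreducible ϖ) (hndvd : ¬ Ideal.span {ϖ} ∣ 𝔪)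
    {RT RU : Finset (GL (Fin 2) (RatFunc F))}
    (hRT : IsCosetReps (Gamma0 𝔪) (heckeMat ϖ hirr.ne_zero) RT)
    (hRU : IsCosetReps (Gamma0 (𝔪 * Ideal.span {ϖ})) (heckeMat ϖ hirr.ne_zero) RU) :
    (heckePoly π (heckeMat ϖ hirr.ne_zero) RT k m n f).coeff h =
      ((n.choose h : CInf F) * embA ϖ ^ h) • (embA ϖ ^ (k - n - h) •
        (degeneracy ϖ hirr.ne_zero f * (-stabE π ϖ hirr.ne_zero) ^ (n - h)) +
          hecke (Gamma0 (𝔪 * Ideal.span {ϖ})) (heckeMat ϖ hirr.ne_zero) RU (k - 2 * h) (m - h)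
            (f * stabE π ϖ hirr.ne_zero ^ (n - h))) := by
  have hϖ : (embA ϖ : CInf F) ≠ 0 := embA_ne_zero hirr.ne_zero
  have hk : k - 2 * n + 2 * (n - h : ℕ) = k - 2 * h := by lia
  have hm : m - n + (n - h : ℕ) = m - h := by lia
  have hU := hecke_mul_stabE_pow h𝔪 hf π (n - h) hirr.ne_zero RU
  rw [coeff_heckePoly, sum_heckeTerm_eq hf π (n - h) hirr hndvd hRT hRU, detC_heckeMat, mul_smul,
    mul_smul, ← hk, ← hm, hU]
  refine congrArg _ ?_
  simp only [smul_add, smul_smul, ← zpow_natCast (embA ϖ) h, ← zpow_add₀ hϖ]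
  congr 3 <;> lia

end HeckePrime

end

end DrinfeldQM

end

theorem theorem5p11 {F : Type*} [Field F] [Fintype F]
    (π : CInf F) (hπ : IsCarlitzPeriod π)
    (𝔪 : Ideal F[X]) (h𝔪 : 𝔪 ≠ ⊥)
    (ϖ : F[X]) (hmonic : ϖ.Monic) (hirr : Irreducible ϖ) (hndvd : ¬ Ideal.span {ϖ} ∣ 𝔪)
    (k m : ℤ) (n : ℕ) (f : Omega F → CInf F)
    (hf : IsModularForm (Gamma0 𝔪) (k - 2 * n) (m - n) f)
    (RT : Finset (GL (Fin 2) (RatFunc F)))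
    (hRT : IsCosetReps (Gamma0 𝔪) (heckeMat ϖ hirr.ne_zero) RT)
    (RU : Finset (GL (Fin 2) (RatFunc F)))
    (hRU : IsCosetReps (Gamma0 (𝔪 * Ideal.span {ϖ})) (heckeMat ϖ hirr.ne_zero) RU) :
    IsQuasiModularForm (Gamma0 𝔪) k m n (fun z => f z * falseE π z ^ n) ∧
    (∀ h ≤ n, IsModularForm (Gamma0 (𝔪 * Ideal.span {ϖ})) (k - 2 * h) (m - h)
      (fun z => f z * stabE π ϖ hirr.ne_zero z ^ (n - h))) ∧
    HasEExpansion π (Gamma0 𝔪) k m n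
      (hecke (Gamma0 𝔪) (heckeMat ϖ hirr.ne_zero) RT k m (fun z => f z * falseE π z ^ n))
      (fun h z => (n.choose h : CInf F) * embA ϖ ^ h *
        (embA ϖ ^ (k - n - h) * degeneracy ϖ hirr.ne_zero f z *
            (-stabE π ϖ hirr.ne_zero z) ^ (n - h) +
          hecke (Gamma0 (𝔪 * Ideal.span {ϖ})) (heckeMat ϖ hirr.ne_zero) RU (k - 2 * h) (m - h)
            (fun w => f w * stabE π ϖ hirr.ne_zero w ^ (n - h)) z)) := by
  refine ⟨isQuasiModularForm_mul_falseE_pow hf π, fun h hn => ?_, ?_⟩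
  · have hk : k - 2 * n + 2 * (n - h : ℕ) = k - 2 * h := by lia
    have hm : m - n + (n - h : ℕ) = m - h := by lia
    exact hk ▸ hm ▸ hf.mul_stabE_pow π hirr.ne_zero (n - h)
  · refine (hasEExpansion_hecke h𝔪 hπ.1 hf hRT).congr fun h hn => ?_
    rw [coeff_heckePoly_heckeMat hn h𝔪 hf π hirr hndvd hRT hRU]
    ext z
    simp only [Pi.smul_apply, Pi.add_apply, Pi.mul_apply, Pi.pow_apply, Pi.neg_apply, smul_eq_mul,
      mul_assoc]
    rfl
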